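/- Consider $N$ users, days $k=0,1,2,\dots$ of $T\ge 1$ slots, a compact price set $\mathcal P\subset[0,p_{\max}]^T$, and a finite set of market price pairs $(\beta_j,\bar\alpha_j)$, $j=1,\dots,M$, with $0\le\beta_j(t)\le\beta_{\max}$ and $0\le\bar\alpha_j(t)\le\alpha_{\max}$, drawn i.i.d. over days with probabilities $\pi_j$. On day $k$, given the pair $j(k)$ drawn for that day, the real-time prices $\alpha(k,t)\in[0,\alpha_{\max}]$ have mean $\bar\alpha_{j(k)}(t)$. The renewable energies and consumption noises $(X(k,t),w_n(k,t))_{n,t}$ are i.i.d. over days, distributed as $(X(t),w_n(t))_{n,t}$, where $0\le X(t)\le x_{\max}$, $w_n(t)\le w_n^{\max}$, $\mathbb E[w_n(t)]=0$, each $X(t)$ and each $w_n(t)$ has a density, and $(w_n(t))_n$ is independent of $X(t)$. The data of different days are independent, and on each day the market prices (the pair and the real-time prices), the vector $(X,w)$ and the company's randomization variable (uniform on $[0,1]$) are independent. At price $p$ in slot $t$, user $n$, whose utility $U_n(\cdot,t)$ is continuous and nondecreasing, plans the load $$L_n^{d}(p,t)=\min\operatorname*{arg\,max}_{L_n^{\min}(t)\le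 L\le L_n^{d,\max}}\mathbb E\big[U_n(L+w_n(t),t)-p\,(L+w_n(t))\big],\qquad L_n^{d,\max}=L_n^{\max}-w_n^{\max},$$ and at an announced price $p(k,t)$ consumes $L_n(k,t)=L_n^d(p(k,t),t)+w_n(k,t)$. Assume that, for all $n$ and $t$, $L_n^d(p(t),t)+w_n(t)\ge L_n^{\min}(t)$ almost surely for all $p\in\mathcal P$, that $L_n^{av}>L_n^{\min}(t)$ and $L_n^{d,\max}\ge L_n^{av}+w_n^{\max}$, and that some price vector $p\in\mathcal P$ satisfies $L_n^d(p(t),t)=L_n^{d,\max}$ for all $n,t$ (which holds, for instance, if $0\in\mathcal P$ and all utilities are strictly increasing). A policy chooses, for each day $k$, prices $p(k)\in\mathcal P$ and base powers $B(k,t)\ge 0$ as measurable functions of the market price pairs and the randomization variables up to day $k$ and of the real-time prices, renewable energies and noises of earlier days. Its welfare on day $k$ is $$\mathrm{Welfare}(k)=\sum_t\Big[\sum_nU_n(L_n(k,t),t)-\beta(k,t)B(k,t)-\alpha(k,t)\Big(\sum_nL_n(k,t)-B(k,t)-X(k,t)\Big)^+\Big],$$ where $\beta(k,t)=\beta_{j(k)}(t)$.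 It is feasible if each $\mathrm{Welfare}(k)$ is integrable and $\liminf_{K}\frac1{KT}\sum_{k<K}\sum_t\mathbb E[L_n(k,t)]\ge L_n^{av}$ for every $n$. Let $\mathrm{Welfare}^*_{av}$ be the supremum of $\liminf_K\frac1K\sum_{k<K}\mathbb E[\mathrm{Welfare}(k)]$ over all feasible policies. Let $Z(t)=X(t)-\sum_nw_n(t)$, with c.d.f. $F_Z(\cdot,t)$, and for $a>0$ let $F_Z^{-1}(a,t)=\inf\{z:F_Z(z,t)=a\}$, with $F_Z^{-1}(0,t)$ read as the essential infimum of $Z(t)$. For a price $p$ put $L^d=\sum_nL_n^d(p,t)$ and let $$B_j^*(p,t)=0\ \text{ if }\bar\alpha_j(t)<\beta_j(t),\qquad B_j^*(p,t)=\big[L^d-F_Z^{-1}(\beta_j(t)/\bar\alpha_j(t),t)\big]^+\ \text{ otherwise}$$ (with $0/0=0$), and $$c_j(p,t)=\beta_j(t)B_j^*(p,t)+\bar\alpha_j(t)\,\mathbb E\big[(L^d-B_j^*(p,t)-Z(t))^+\big].$$ Then $\mathrm{Welfare}^*_{av}$ is equal to $$\sup\ \sum_j\pi_j\sum_{t}\sum_{m=1}^\infty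 a_m^{j}\Big(\sum_n\mathbb E\big[U_n(L_n^d(p^j_m(t),t)+w_n(t),t)\big]-c_j(p_m^j(t),t)\Big)$$ over all price vectors $p_m^j\in\mathcal P$ and weights $a_m^j\ge0$ with $\sum_{m}a_m^j=1$ for each $j$, subject to $$TL_n^{av}\le\sum_j\pi_j\sum_t\sum_{m=1}^\infty a_m^jL_n^d(p_m^j(t),t)\qquad\text{for every }n.$$ -/

import Mathlib

open MeasureTheory ProbabilityTheory Filter

namespace SmartGrid

noncomputable section

/-- Data of the power market with `N` users, `T` slots per day and `M` possible market price pairs. -/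
structure Model (N T M : ℕ) where
  /-- feasible user price vectors -/
  P : Set (Fin T → ℝ)
  /-- upper bound on user prices -/
  pMax : ℝ
  /-- `U n t L`: utility of user `n` for consuming the load `L` in slot `t` -/
  U : Fin N → Fin T → ℝ → ℝ
  /-- minimum loads -/
  Lmin : Fin N → Fin T → ℝ
  /-- maximum loads -/
  Lmax : Fin N → ℝ
  /-- upper bounds on the consumption noise -/
  wMax : Fin N → ℝ
  /-- required average loads (quality of usage) -/
  Lav : Fin N → ℝ
  /-- renewable capacity -/
  xMax : ℝ
  /-- upper bound on the real-time market prices -/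
  alphaMax : ℝ
  /-- upper bound on the day-ahead market prices -/
  betaMax : ℝ
  /-- joint law, on one day, of the renewable energies `(X t)` and of the noises `(w n t)` -/
  shockLaw : Measure ((Fin T → ℝ) × (Fin N → Fin T → ℝ))
  /-- day-ahead price vectors of the market price set -/
  beta : Fin M → Fin T → ℝ
  /-- expected real-time price vectors of the market price set -/
  alphaBar : Fin M → Fin T → ℝ
  /-- distribution on the market price set -/
  marketProb : Fin M → ℝ

namespace Model

variable {N T M : ℕ} (D : Model N T M)

/-- Maximum planned load `Lmax - wMax`. -/
def LdMax (n : Fin N) : ℝ := D.Lmax n - D.wMax n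

/-- Expected utility minus expected payment of user `n` in slot `t`, for the planned load `L` at
price `p`. -/
def surplus (n : Fin N) (t : Fin T) (p L : ℝ) : ℝ :=
  ∫ s, (D.U n t (L + s.2 n t) - p * (L + s.2 n t)) ∂D.shockLaw

/-- Optimal planned loads of user `n` in slot `t` at price `p`. -/
def loadArgmax (n : Fin N) (t : Fin T) (p : ℝ) : Set ℝ :=
  {L | L ∈ Set.Icc (D.Lmin n t) (D.LdMax n) ∧
    IsMaxOn (D.surplus n t p) (Set.Icc (D.Lmin n t) (D.LdMax n)) L}

/-- Planned load: the least optimal one. -/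
def plannedLoad (n : Fin N) (t : Fin T) (p : ℝ) : ℝ := sInf (D.loadArgmax n t p)

/-- Aggregate planned load in slot `t` at price `p`. -/
def totalPlannedLoad (t : Fin T) (p : ℝ) : ℝ := ∑ n, D.plannedLoad n t p

/-- Effective renewable energy `Z t = X t - ∑ n, w n t`. -/
def effRenewable (t : Fin T) (s : (Fin T → ℝ) × (Fin N → Fin T → ℝ)) : ℝ :=
  s.1 t - ∑ n, s.2 n t

/-- The c.d.f. of `Z t`. -/
def effCdf (t : Fin T) (z : ℝ) : ℝ := cdf (D.shockLaw.map (effRenewable t)) z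

/-- The inverse c.d.f. `inf {z | F z = a}` of `Z t`. At `a = 0`, where this infimum is `-∞`, it is
the (finite) essential infimum of `Z t`. -/
def effQuantile (t : Fin T) (a : ℝ) : ℝ :=
  if a = 0 then sSup {z | D.effCdf t z = 0} else sInf {z | D.effCdf t z = a}

/-- Base power procured for the aggregate planned load `L` in slot `t` when the market price pair
is the `j`-th one: `0` if `alphaBar / beta < 1` and `[L - F⁻¹ (beta / alphaBar)]⁺` otherwise. -/
def optBase (j : Fin M) (t : Fin T) (L : ℝ) : ℝ :=
  if D.alphaBar j t < D.beta j t then 0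
  else max (L - D.effQuantile t (D.beta j t / D.alphaBar j t)) 0

/-- Expected utility of all users in slot `t` at price `p`. -/
def meanUtility (t : Fin T) (p : ℝ) : ℝ :=
  ∑ n, ∫ s, D.U n t (D.plannedLoad n t p + s.2 n t) ∂D.shockLaw

/-- Expected cost in slot `t` at user price `p` under the `j`-th market price pair, with base power
`optBase`. -/
def meanCost (j : Fin M) (t : Fin T) (p : ℝ) : ℝ :=
  D.beta j t * D.optBase j t (D.totalPlannedLoad t p) +
    D.alphaBar j t * ∫ s, max (∑ n, (D.plannedLoad n t p + s.2 n t)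
      - D.optBase j t (D.totalPlannedLoad t p) - s.1 t) 0 ∂D.shockLaw

/-- The standing assumptions on the data. -/
structure Assumptions : Prop where
  compact_P : IsCompact D.P
  P_bounds : ∀ p ∈ D.P, ∀ t, 0 ≤ p t ∧ p t ≤ D.pMax
  U_mono : ∀ n t, Monotone (D.U n t)
  U_cont : ∀ n t, Continuous (D.U n t)
  prob_shock : IsProbabilityMeasure D.shockLaw
  X_bounds : ∀ t, ∀ᵐ s ∂D.shockLaw, 0 ≤ s.1 t ∧ s.1 t ≤ D.xMax
  /-- `X t` has a density -/
  X_cont : ∀ t, D.shockLaw.map (fun s => s.1 t) ≪ volume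
  w_le : ∀ n t, ∀ᵐ s ∂D.shockLaw, s.2 n t ≤ D.wMax n
  w_mean : ∀ n t, ∫ s, s.2 n t ∂D.shockLaw = 0
  /-- `w n t` has a density -/
  w_cont : ∀ n t, D.shockLaw.map (fun s => s.2 n t) ≪ volume
  /-- in each slot the noises are independent of the renewable energy -/
  w_indep_X : ∀ t, IndepFun (fun s : (Fin T → ℝ) × (Fin N → Fin T → ℝ) => fun n => s.2 n t)
    (fun s => s.1 t) D.shockLaw
  /-- actual loads never fall below the minimum load -/
  load_ge : ∀ p ∈ D.P, ∀ n t, ∀ᵐ s ∂D.shockLaw, D.Lmin n t ≤ D.plannedLoad n t (p t) + s.2 n t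
  Lmin_lt_Lav : ∀ n t, D.Lmin n t < D.Lav n
  Lav_le : ∀ n, D.Lav n + D.wMax n ≤ D.LdMax n
  /-- the market price pairs are distinct -/
  market_inj : Function.Injective (fun j => (D.beta j, D.alphaBar j))
  beta_bounds : ∀ j t, 0 ≤ D.beta j t ∧ D.beta j t ≤ D.betaMax
  alphaBar_bounds : ∀ j t, 0 ≤ D.alphaBar j t ∧ D.alphaBar j t ≤ D.alphaMax
  marketProb_nonneg : ∀ j, 0 ≤ D.marketProb j
  marketProb_sum : ∑ j, D.marketProb j = 1

/-! ### The static program -/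

/-- A stationary randomized pricing rule: for each market price pair `j`, the price vector
`price j m` is announced, to all users, with probability `weight j m`. -/
structure StationaryRule where
  price : Fin M → ℕ → Fin T → ℝ
  weight : Fin M → ℕ → ℝ
  price_mem : ∀ j m, price j m ∈ D.P
  weight_nonneg : ∀ j m, 0 ≤ weight j m
  weight_sum : ∀ j, HasSum (weight j) 1

namespace StationaryRule

variable {D} (R : D.StationaryRule)

def utilityAv : ℝ :=
  ∑ j, D.marketProb j * ∑ t, ∑' m, R.weight j m * D.meanUtility t (R.price j m t)

def costAv : ℝ :=
  ∑ j, D.marketProb j * ∑ t, ∑' m, R.weight j m * D.meanCost j t (R.price j m t)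

/-- Expected load of user `n` over one day. -/
def loadAv (n : Fin N) : ℝ :=
  ∑ j, D.marketProb j * ∑ t, ∑' m, R.weight j m * D.plannedLoad n t (R.price j m t)

/-- The per-user quality-of-usage constraints. -/
def Feasible : Prop := ∀ n, (T : ℝ) * D.Lav n ≤ R.loadAv n

end StationaryRule

/-- Optimal value of the static program. -/
def staticValue : EReal :=
  sSup {v : EReal | ∃ R : D.StationaryRule, R.Feasible ∧ v = ((R.utilityAv - R.costAv : ℝ) : EReal)}

/-! ### The dynamic problem -/

/-- The random quantities that drive the system, on a probability space: they are independent from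
day to day, and on each day the market prices, the pair (renewable energies, noises) and the
randomization variable of the utility company are independent of each other. -/
structure Realization {Ω : Type*} [MeasurableSpace Ω] (μ : Measure Ω) where
  /-- index of the market price pair of day `k` -/
  market : ℕ → Ω → Fin M
  /-- real-time prices `α (k, t)` -/
  rtPrice : ℕ → Ω → Fin T → ℝ
  /-- renewable energies `X (k, t)` -/
  renewable : ℕ → Ω → Fin T → ℝ
  /-- noises `w n (k, t)` -/
  noise : ℕ → Ω → Fin N → Fin T → ℝ
  /-- source of randomization for the decisions of day `k` -/
  seed : ℕ → Ω → ℝ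
  measurable_market : ∀ k, Measurable (market k)
  measurable_rtPrice : ∀ k, Measurable (rtPrice k)
  measurable_renewable : ∀ k, Measurable (renewable k)
  measurable_noise : ∀ k, Measurable (noise k)
  measurable_seed : ∀ k, Measurable (seed k)
  market_law : ∀ k j, μ.real (market k ⁻¹' {j}) = D.marketProb j
  shock_law : ∀ k, μ.map (fun ω => (renewable k ω, noise k ω)) = D.shockLaw
  seed_law : ∀ k, μ.map (seed k) = volume.restrict (Set.Icc (0 : ℝ) 1)
  rtPrice_bounds : ∀ k t, ∀ᵐ ω ∂μ, 0 ≤ rtPrice k ω t ∧ rtPrice k ω t ≤ D.alphaMax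
  /-- given the market price pair `j`, the real-time price has mean `alphaBar j t` -/
  rtPrice_mean : ∀ k j t,
    ∫ ω in market k ⁻¹' {j}, rtPrice k ω t ∂μ = D.marketProb j * D.alphaBar j t
  indep_days : iIndepFun
    (fun k ω => (market k ω, rtPrice k ω, renewable k ω, noise k ω, seed k ω)) μ
  indep_market_shock : ∀ k, IndepFun (fun ω => (market k ω, rtPrice k ω))
    (fun ω => (renewable k ω, noise k ω)) μ
  indep_seed : ∀ k, IndepFun (seed k)
    (fun ω => (market k ω, rtPrice k ω, renewable k ω, noise k ω)) μ

namespace Realization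

variable {D} {Ω : Type*} [MeasurableSpace Ω] {μ : Measure Ω} (S : D.Realization μ)

/-- Information on which the decisions for day `k` may depend: market price pairs and randomization
variables up to day `k`, and renewable energies, noises and real-time prices of earlier days. -/
@[reducible] def info (k : ℕ) : MeasurableSpace Ω :=
  (⨆ i ≤ k, MeasurableSpace.comap (fun ω => (S.market i ω, S.seed i ω)) inferInstance) ⊔
  (⨆ i < k, MeasurableSpace.comap
    (fun ω => (S.rtPrice i ω, S.renewable i ω, S.noise i ω)) inferInstance)

/-- A pricing and procurement policy: history-dependent, randomized and non-anticipating. -/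
structure Policy where
  /-- prices `p (k, t)` announced to the users for day `k` -/
  price : ℕ → Ω → Fin T → ℝ
  /-- base power `B (k, t)` bought day-ahead -/
  base : ℕ → Ω → Fin T → ℝ
  price_adapted : ∀ k, Measurable[S.info k] (price k)
  base_adapted : ∀ k, Measurable[S.info k] (base k)
  price_mem : ∀ k ω, price k ω ∈ D.P
  base_nonneg : ∀ k ω t, 0 ≤ base k ω t

namespace Policy

variable {S} (A : S.Policy)

/-- Actual load of user `n`. -/
def load (n : Fin N) (k : ℕ) (t : Fin T) (ω : Ω) : ℝ :=
  D.plannedLoad n t (A.price k ω t) + S.noise k ω n t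

/-- Cost in slot `t` of day `k`: base power at the day-ahead price, plus the power deficit at the
real-time price. -/
def cost (k : ℕ) (t : Fin T) (ω : Ω) : ℝ :=
  D.beta (S.market k ω) t * A.base k ω t +
    S.rtPrice k ω t * max (∑ n, A.load n k t ω - A.base k ω t - S.renewable k ω t) 0

def welfare (k : ℕ) (ω : Ω) : ℝ :=
  ∑ t, (∑ n, D.U n t (A.load n k t ω) - A.cost k t ω)

/-- Expected average welfare. -/
def welfareAv : EReal :=
  liminf (fun K : ℕ => (((1 / (K : ℝ)) * ∑ k ∈ Finset.range K, ∫ ω, A.welfare k ω ∂μ : ℝ) : EReal))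
    atTop

/-- Feasibility: the quality-of-usage constraint of every user. The welfare of each day is required
to be integrable; as utilities are bounded and costs are nonnegative, this only discards policies
with infinite expected cost on some day, whose average welfare is `-∞`. -/
def Feasible : Prop :=
  (∀ k, Integrable (A.welfare k) μ) ∧
  ∀ n, (D.Lav n : EReal) ≤ liminf (fun K : ℕ => (((1 / ((K : ℝ) * (T : ℝ))) *
    ∑ k ∈ Finset.range K, ∑ t, ∫ ω, A.load n k t ω ∂μ : ℝ) : EReal)) atTop

end Policy

/-- Optimal average welfare over all feasible policies. -/
def optimalWelfare : EReal :=
  sSup {v : EReal | ∃ A : S.Policy, A.Feasible ∧ v = A.welfareAv}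

end Realization

end Model

end

end SmartGrid

/-! Both problems see only daily expectations, so the dependence of a policy on the past matters
only through the expected outcome of each day.

Upper bound. The decisions of day `k` are functions of the price pair of that day and of the
history, that is, the earlier days and the current seed. The history is independent of the prices
and shocks of day `k`. Splitting over the value `j` of the pair (`dayWelfare_eq_sum`) and using this
independence, the real-time price is replaced by `alphaBar j` and the shocks are integrated out
(`integral_dayWelfare`). For fixed prices, the choice of base power is a newsvendor problem, solved
by `optBase` (`expCost_optBase_le`). Hence, for each `j`, the expected loads of a day and a bound on
its expected welfare come from the mean of a random point of `outcome j '' P`, which lies in the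
closed convex hull (`exists_outcome`). Averages over the first `K` days stay in that set, and for
suitable large `K` they nearly satisfy the load constraints and nearly reach the average welfare. A
point of the closure is approximated by a finite mixture of prices. Adding a small weight of the
full-load price, which exceeds each requirement by at least `wMax > 0` per slot, restores exact
feasibility at a vanishing loss (`le_staticValue`). Since only closures are used, planned loads need
not be continuous in the price.

Lower bound. The uniform seed of each day selects `m` with probability `weight j m`, and `optBase`
supplies the base power. All daily expectations then equal the static ones
(`exists_policy_of_rule`). -/

namespace SmartGrid

/-! ### Expectations of continuous functions of a bounded noise. -/

section BoundedNoise

variable {α : Type*} [MeasurableSpace α] {ν : Measure α} [IsProbabilityMeasure ν]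
  {f : ℝ → ℝ} {w : α → ℝ} {C : ℝ}

-- The exceptional null set does not depend on `L`, so the bound also applies when `L` is a random
-- planned load.
omit [IsProbabilityMeasure ν] in
lemma exists_bound_comp_add (hf : Continuous f) (hC : ∀ᵐ a ∂ν, |w a| ≤ C) (R : ℝ) :
    ∃ K, ∀ᵐ a ∂ν, ∀ L, |L| ≤ R → |f (L + w a)| ≤ K := by
  obtain ⟨K, hK⟩ := (isCompact_Icc (a := -(R + C)) (b := R + C)).exists_bound_of_continuousOn
    hf.continuousOn
  refine ⟨K, ?_⟩
  filter_upwards [hC] with a ha L hL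
  refine hK _ ?_
  rw [abs_le] at ha hL
  constructor <;> linarith

lemma integrable_comp_add (hf : Continuous f) (hw : Measurable w) (hC : ∀ᵐ a ∂ν, |w a| ≤ C)
    (L : ℝ) : Integrable (fun a => f (L + w a)) ν := by
  obtain ⟨K, hK⟩ := exists_bound_comp_add hf hC |L|
  refine Integrable.of_bound (hf.measurable.comp (hw.const_add L)).aestronglyMeasurable K ?_
  filter_upwards [hK] with a ha
  exact ha L le_rfl

lemma continuous_integral_comp_add (hf : Continuous f) (hw : Measurable w)
    (hC : ∀ᵐ a ∂ν, |w a| ≤ C) : Continuous fun L => ∫ a, f (L + w a) ∂ν := by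
  rw [continuous_iff_continuousAt]
  intro L
  obtain ⟨K, hK⟩ := exists_bound_comp_add hf hC (|L| + 1)
  refine continuousAt_of_dominated (bound := fun _ => K)
    (Eventually.of_forall fun x => (integrable_comp_add hf hw hC x).aestronglyMeasurable)
    ?_ (integrable_const _) (Eventually.of_forall fun a => by fun_prop)
  filter_upwards [Metric.ball_mem_nhds L one_pos] with x hx
  filter_upwards [hK] with a ha
  refine ha x ?_
  rw [Metric.mem_ball, Real.dist_eq] at hx
  have := abs_sub_abs_le_abs_sub x L
  linarith

end BoundedNoise

/-! ### Planned loads, and the newsvendor problem of one slot. -/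

namespace Model

variable {N T M : ℕ} {D : Model N T M}

/-- Expected utility of user `n` in slot `t` for the planned load `L`. -/
noncomputable def expUtility (D : Model N T M) (n : Fin N) (t : Fin T) (L : ℝ) : ℝ :=
  ∫ s, D.U n t (L + s.2 n t) ∂D.shockLaw

/-- Expected power deficit in slot `t` when the aggregate planned load exceeds the base power
by `l`. -/
noncomputable def expDeficit (D : Model N T M) (t : Fin T) (l : ℝ) : ℝ :=
  ∫ s, max (l - effRenewable t s) 0 ∂D.shockLaw

/-- Expected cost in slot `t` of procuring the base power `B` for the aggregate planned load `L`. -/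
noncomputable def expCost (D : Model N T M) (j : Fin M) (t : Fin T) (L B : ℝ) : ℝ :=
  D.beta j t * B + D.alphaBar j t * D.expDeficit t (L - B)

lemma measurable_noise_coord (n : Fin N) (t : Fin T) :
    Measurable fun s : (Fin T → ℝ) × (Fin N → Fin T → ℝ) => s.2 n t :=
  measurable_pi_apply t |>.comp (measurable_pi_apply n |>.comp measurable_snd)

lemma measurable_effRenewable (t : Fin T) :
    Measurable (effRenewable t : (Fin T → ℝ) × (Fin N → Fin T → ℝ) → ℝ) :=
  ((measurable_pi_apply t).comp measurable_fst).sub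
    (Finset.measurable_sum _ fun n _ => measurable_noise_coord n t)

lemma meanCost_eq (j : Fin M) (t : Fin T) (p : ℝ) :
    D.meanCost j t p = D.expCost j t (D.totalPlannedLoad t p)
      (D.optBase j t (D.totalPlannedLoad t p)) := by
  unfold meanCost expCost expDeficit
  congr 3
  ext s
  congr 1
  simp only [effRenewable, totalPlannedLoad, Finset.sum_add_distrib]
  ring

lemma continuous_optBase (j : Fin M) (t : Fin T) : Continuous (D.optBase j t) := by
  unfold optBase
  split_ifs <;> fun_prop

lemma optBase_nonneg (j : Fin M) (t : Fin T) (L : ℝ) : 0 ≤ D.optBase j t L := by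
  unfold optBase
  split_ifs
  · rfl
  · exact le_max_right _ _

namespace Assumptions

/-- The upper bound is assumed; the lower one comes from `load_ge` at a single feasible price. There
the planned load serves merely as some fixed number, since its place in the load interval is proved
later and relies on this bound. -/
lemma exists_noise_bound (hD : D.Assumptions) (hP : D.P.Nonempty) :
    ∃ C, 0 ≤ C ∧ ∀ n t, ∀ᵐ s ∂D.shockLaw, |s.2 n t| ≤ C := by
  obtain ⟨p, hp⟩ := hP
  set c : Fin N → Fin T → ℝ := fun n t => |D.wMax n| + |D.Lmin n t - D.plannedLoad n t (p t)|
    with hc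
  have hc0 : ∀ n t, 0 ≤ c n t := fun n t => by positivity
  refine ⟨∑ n, ∑ t, c n t, Finset.sum_nonneg fun n _ => Finset.sum_nonneg fun t _ => hc0 n t, ?_⟩
  intro n t
  have hle : c n t ≤ ∑ n, ∑ t, c n t :=
    (Finset.single_le_sum (fun t _ => hc0 n t) (Finset.mem_univ t)).trans
      (Finset.single_le_sum (f := fun n => ∑ t, c n t)
        (fun n _ => Finset.sum_nonneg fun t _ => hc0 n t) (Finset.mem_univ n))
  filter_upwards [hD.w_le n t, hD.load_ge p hp n t] with s h1 h2
  refine le_trans ?_ hle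
  have h3 := le_abs_self (D.wMax n)
  have h4 := neg_abs_le (D.Lmin n t - D.plannedLoad n t (p t))
  have h5 := abs_nonneg (D.wMax n)
  have h6 := abs_nonneg (D.Lmin n t - D.plannedLoad n t (p t))
  rw [hc, abs_le]
  constructor <;> linarith

lemma integrable_noise (hD : D.Assumptions) (hP : D.P.Nonempty) (n : Fin N) (t : Fin T) :
    Integrable (fun s => s.2 n t) D.shockLaw := by
  have := hD.prob_shock
  obtain ⟨C, -, hC⟩ := hD.exists_noise_bound hP
  exact Integrable.of_bound (measurable_noise_coord n t).aestronglyMeasurable C (hC n t)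

/-- A nonpositive variable of mean zero vanishes almost surely, which a density forbids. This
positivity is the slack that the mixing argument for the constraints needs. -/
lemma wMax_pos (hD : D.Assumptions) (hP : D.P.Nonempty) (hT : 0 < T) (n : Fin N) :
    0 < D.wMax n := by
  have := hD.prob_shock
  by_contra! h
  let t : Fin T := ⟨0, hT⟩
  have h1 : (fun s : (Fin T → ℝ) × (Fin N → Fin T → ℝ) => -s.2 n t) =ᵐ[D.shockLaw] 0 := by
    refine (integral_eq_zero_iff_of_nonneg_ae ?_ (hD.integrable_noise hP n t).neg).1 ?_
    rotate_left
    · simp only [Pi.neg_apply]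
      rw [integral_neg, hD.w_mean n t, neg_zero]
    · filter_upwards [hD.w_le n t] with s hs
      simp only [Pi.zero_apply, Pi.neg_apply]
      linarith
  have h2 : D.shockLaw.map (fun s => s.2 n t) {0} = 0 := hD.w_cont n t (by simp)
  rw [Measure.map_apply (measurable_noise_coord n t) (measurableSet_singleton 0)] at h2
  have h3 : ∀ᵐ s ∂D.shockLaw, s.2 n t ≠ 0 := by
    rw [ae_iff]
    simpa [Set.preimage] using h2
  obtain ⟨s, hs, hs'⟩ := (h1.and h3).exists
  exact hs' (by simpa using hs)

lemma Lmin_lt_LdMax (hD : D.Assumptions) (hP : D.P.Nonempty) (n : Fin N) (t : Fin T) :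
    D.Lmin n t < D.LdMax n := by
  have h1 := hD.Lmin_lt_Lav n t
  have h2 := hD.Lav_le n
  have h3 := hD.wMax_pos hP t.pos n
  linarith

lemma continuous_expUtility (hD : D.Assumptions) (hP : D.P.Nonempty) (n : Fin N) (t : Fin T) :
    Continuous (D.expUtility n t) := by
  have := hD.prob_shock
  obtain ⟨C, -, hC⟩ := hD.exists_noise_bound hP
  exact continuous_integral_comp_add (hD.U_cont n t) (measurable_noise_coord n t) (hC n t)

/-- The noise has mean zero and drops out of the expected payment. -/
lemma surplus_eq (hD : D.Assumptions) (hP : D.P.Nonempty) (n : Fin N) (t : Fin T) (p L : ℝ) :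
    D.surplus n t p L = D.expUtility n t L - p * L := by
  have := hD.prob_shock
  obtain ⟨C, -, hC⟩ := hD.exists_noise_bound hP
  unfold surplus expUtility
  have hw := hD.integrable_noise hP n t
  have hpay : Integrable (fun s => p * (L + s.2 n t)) D.shockLaw :=
    ((integrable_const L).add hw).const_mul p
  rw [integral_sub (integrable_comp_add (hD.U_cont n t) (measurable_noise_coord n t) (hC n t) L)
    hpay, integral_const_mul, integral_add (integrable_const L) hw, hD.w_mean n t]
  simp

/-- The optimal set is a nonempty closed superlevel set in a compact interval, so it contains its
infimum. -/
lemma plannedLoad_mem_loadArgmax (hD : D.Assumptions) (hP : D.P.Nonempty) (n : Fin N) (t : Fin T)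
    (p : ℝ) : D.plannedLoad n t p ∈ D.loadArgmax n t p := by
  have hcont : Continuous (D.surplus n t p) := by
    have h := hD.continuous_expUtility hP n t
    rw [funext (hD.surplus_eq hP n t p)]
    fun_prop
  obtain ⟨L, hL, hmax⟩ := (isCompact_Icc (a := D.Lmin n t) (b := D.LdMax n)).exists_isMaxOn
    (Set.nonempty_Icc.2 (hD.Lmin_lt_LdMax hP n t).le) hcont.continuousOn
  have heq : D.loadArgmax n t p
      = Set.Icc (D.Lmin n t) (D.LdMax n) ∩ {x | D.surplus n t p L ≤ D.surplus n t p x} := by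
    ext x
    constructor
    · exact fun hx => ⟨hx.1, hx.2 hL⟩
    · exact fun hx => ⟨hx.1, fun y hy =>
        (show D.surplus n t p y ≤ D.surplus n t p x from le_trans (hmax hy) hx.2)⟩
  have hcomp : IsCompact (D.loadArgmax n t p) := by
    rw [heq]
    exact isCompact_Icc.inter_right (isClosed_le continuous_const hcont)
  exact hcomp.sInf_mem ⟨L, hL, hmax⟩

lemma plannedLoad_mem_Icc (hD : D.Assumptions) (hP : D.P.Nonempty) (n : Fin N) (t : Fin T)
    (p : ℝ) : D.plannedLoad n t p ∈ Set.Icc (D.Lmin n t) (D.LdMax n) :=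
  (hD.plannedLoad_mem_loadArgmax hP n t p).1

/-- Exchange argument: adding the two optimality inequalities gives `(q - p) * (L q - L p) ≤ 0`.
Monotonicity is what makes planned loads measurable in the price. -/
lemma plannedLoad_antitone (hD : D.Assumptions) (hP : D.P.Nonempty) (n : Fin N) (t : Fin T) :
    Antitone (D.plannedLoad n t) := by
  intro p q hpq
  rcases hpq.eq_or_lt with rfl | hlt
  · rfl
  by_contra! h
  have h1 := hD.plannedLoad_mem_loadArgmax hP n t p
  have h2 := hD.plannedLoad_mem_loadArgmax hP n t q
  have h3 := h1.2 h2.1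
  have h4 := h2.2 h1.1
  simp only [Set.mem_ofPred_eq, hD.surplus_eq hP] at h3 h4
  nlinarith

lemma measurable_plannedLoad (hD : D.Assumptions) (hP : D.P.Nonempty) (n : Fin N) (t : Fin T) :
    Measurable (D.plannedLoad n t) :=
  (hD.plannedLoad_antitone hP n t).measurable

lemma measurable_totalPlannedLoad (hD : D.Assumptions) (hP : D.P.Nonempty) (t : Fin T) :
    Measurable (D.totalPlannedLoad t) :=
  Finset.measurable_sum _ fun n _ => hD.measurable_plannedLoad hP n t

lemma exists_plannedLoad_bound (hD : D.Assumptions) (hP : D.P.Nonempty) :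
    ∃ C, 0 ≤ C ∧ ∀ n t p, |D.plannedLoad n t p| ≤ C := by
  set c : Fin N → Fin T → ℝ := fun n t => |D.Lmin n t| + |D.LdMax n| with hc
  have hc0 : ∀ n t, 0 ≤ c n t := fun n t => by positivity
  refine ⟨∑ n, ∑ t, c n t, Finset.sum_nonneg fun n _ => Finset.sum_nonneg fun t _ => hc0 n t, ?_⟩
  intro n t p
  have hle : c n t ≤ ∑ n, ∑ t, c n t :=
    (Finset.single_le_sum (fun t _ => hc0 n t) (Finset.mem_univ t)).trans
      (Finset.single_le_sum (f := fun n => ∑ t, c n t)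
        (fun n _ => Finset.sum_nonneg fun t _ => hc0 n t) (Finset.mem_univ n))
  refine le_trans ?_ hle
  obtain ⟨h1, h2⟩ := hD.plannedLoad_mem_Icc hP n t p
  have h3 := le_abs_self (D.LdMax n)
  have h4 := neg_abs_le (D.Lmin n t)
  have h5 := abs_nonneg (D.LdMax n)
  have h6 := abs_nonneg (D.Lmin n t)
  rw [hc, abs_le]
  constructor <;> linarith

lemma exists_totalPlannedLoad_bound (hD : D.Assumptions) (hP : D.P.Nonempty) :
    ∃ C, 0 ≤ C ∧ ∀ t p, |D.totalPlannedLoad t p| ≤ C := by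
  obtain ⟨C, hC0, hC⟩ := hD.exists_plannedLoad_bound hP
  refine ⟨N * C, by positivity, fun t p => (Finset.abs_sum_le_sum_abs _ _).trans ?_⟩
  refine (Finset.sum_le_sum fun n _ => hC n t p).trans ?_
  simp

lemma exists_effRenewable_bound (hD : D.Assumptions) (hP : D.P.Nonempty) :
    ∃ C, 0 ≤ C ∧ ∀ t, ∀ᵐ s ∂D.shockLaw, |effRenewable t s| ≤ C := by
  obtain ⟨C, hC0, hC⟩ := hD.exists_noise_bound hP
  refine ⟨|D.xMax| + N * C, by positivity, fun t => ?_⟩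
  filter_upwards [hD.X_bounds t, ae_all_iff.2 fun n => hC n t] with s h1 h2
  have h3 : |∑ n, s.2 n t| ≤ N * C :=
    (Finset.abs_sum_le_sum_abs _ _).trans ((Finset.sum_le_sum fun n _ => h2 n).trans (by simp))
  have h4 : |s.1 t| ≤ |D.xMax| := abs_le_abs_of_nonneg h1.1 h1.2
  exact (abs_sub _ _).trans (add_le_add h4 h3)

lemma integrable_deficit (hD : D.Assumptions) (hP : D.P.Nonempty) (t : Fin T) (l : ℝ) :
    Integrable (fun s => max (l - effRenewable t s) 0) D.shockLaw := by
  have := hD.prob_shock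
  obtain ⟨C, -, hC⟩ := hD.exists_effRenewable_bound hP
  refine Integrable.of_bound (((measurable_effRenewable t).const_sub l).max
    measurable_const).aestronglyMeasurable (|l| + C) ?_
  filter_upwards [hC t] with s hs
  rw [Real.norm_eq_abs, abs_of_nonneg (le_max_right _ _)]
  refine max_le ?_ (by have := abs_nonneg l; have := abs_nonneg (effRenewable t s); linarith)
  have := le_abs_self l
  have := neg_abs_le (effRenewable t s)
  linarith

lemma continuous_expDeficit (hD : D.Assumptions) (hP : D.P.Nonempty) (t : Fin T) :
    Continuous (D.expDeficit t) := by
  have := hD.prob_shock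
  obtain ⟨C, -, hC⟩ := hD.exists_effRenewable_bound hP
  have h := continuous_integral_comp_add (ν := D.shockLaw) (f := fun x => max x 0)
    (w := fun s => -effRenewable t s) (C := C) (by fun_prop) (measurable_effRenewable t).neg
    (by simpa using hC t)
  simp only [← sub_eq_add_neg] at h
  exact h

/-- The effective renewable energy has no atoms: it is the sum of independent variables one of
which has a density. -/
lemma effRenewable_singleton (hD : D.Assumptions) (t : Fin T) (z : ℝ) :
    D.shockLaw.map (effRenewable t) {z} = 0 := by
  have := hD.prob_shock
  have mw : Measurable (fun s : (Fin T → ℝ) × (Fin N → Fin T → ℝ) => fun n => s.2 n t) :=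
    measurable_pi_lambda _ fun n => measurable_noise_coord n t
  have mx : Measurable (fun s : (Fin T → ℝ) × (Fin N → Fin T → ℝ) => s.1 t) :=
    (measurable_pi_apply t).comp measurable_fst
  have hprod := (indepFun_iff_map_prod_eq_prod_map_map mw.aemeasurable mx.aemeasurable).1
    (hD.w_indep_X t)
  have hset : MeasurableSet {q : (Fin N → ℝ) × ℝ | q.2 - ∑ n, q.1 n = z} :=
    (measurable_snd.sub (Finset.measurable_sum _ fun n _ =>
      (measurable_pi_apply n).comp measurable_fst)) (measurableSet_singleton z)
  have h1 : D.shockLaw.map (effRenewable t) {z}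
      = D.shockLaw.map (fun s => ((fun n => s.2 n t), s.1 t))
        {q : (Fin N → ℝ) × ℝ | q.2 - ∑ n, q.1 n = z} := by
    rw [Measure.map_apply (measurable_effRenewable t) (measurableSet_singleton z),
      Measure.map_apply (mw.prodMk mx) hset]
    rfl
  have : IsProbabilityMeasure (D.shockLaw.map (fun s => s.1 t)) :=
    Measure.isProbabilityMeasure_map mx.aemeasurable
  rw [h1, hprod, Measure.measure_prod_null hset]
  refine Eventually.of_forall fun w => ?_
  refine hD.X_cont t ?_
  have : Prod.mk w ⁻¹' {q : (Fin N → ℝ) × ℝ | q.2 - ∑ n, q.1 n = z} = {z + ∑ n, w n} := by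
    ext x
    simp [sub_eq_iff_eq_add]
  rw [this]
  simp

lemma effCdf_eq (hD : D.Assumptions) (t : Fin T) (z : ℝ) :
    D.effCdf t z = D.shockLaw.real {s | effRenewable t s ≤ z} := by
  have := hD.prob_shock
  have : IsProbabilityMeasure (D.shockLaw.map (effRenewable t)) :=
    Measure.isProbabilityMeasure_map (measurable_effRenewable t).aemeasurable
  rw [effCdf, cdf_eq_real, measureReal_def, Measure.map_apply (measurable_effRenewable t)
    measurableSet_Iic]
  rfl

lemma continuous_effCdf (hD : D.Assumptions) (t : Fin T) : Continuous (D.effCdf t) := by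
  have := hD.prob_shock
  have : IsProbabilityMeasure (D.shockLaw.map (effRenewable t)) :=
    Measure.isProbabilityMeasure_map (measurable_effRenewable t).aemeasurable
  rw [continuous_iff_continuousAt]
  intro z
  unfold effCdf
  rw [(monotone_cdf _).continuousAt_iff_leftLim_eq_rightLim, StieltjesFunction.rightLim_eq]
  have h := (cdf (D.shockLaw.map (effRenewable t))).measure_singleton z
  rw [measure_cdf, hD.effRenewable_singleton t z] at h
  refine le_antisymm ((monotone_cdf _).leftLim_le le_rfl) ?_
  have := ENNReal.ofReal_eq_zero.1 h.symm
  linarith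

/-- A level set of the continuous c.d.f. is closed, and nonempty by the intermediate value theorem,
so it contains its finite endpoints. For `a ≠ 0` it is bounded below; for `a = 0` it is only bounded
above, hence the supremum in `effQuantile`. -/
lemma effCdf_effQuantile (hD : D.Assumptions) (hP : D.P.Nonempty) (t : Fin T) {a : ℝ}
    (h0 : 0 ≤ a) (h1 : a ≤ 1) : D.effCdf t (D.effQuantile t a) = a := by
  have := hD.prob_shock
  obtain ⟨C, hC0, hC⟩ := hD.exists_effRenewable_bound hP
  have hlow : D.effCdf t (-C - 1) = 0 := by
    rw [hD.effCdf_eq, measureReal_eq_zero_iff]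
    refine measure_mono_null (t := {s | ¬ |effRenewable t s| ≤ C}) (fun s hs => ?_) (hC t)
    simp only [Set.mem_ofPred_eq] at hs ⊢
    intro h
    rw [abs_le] at h
    linarith
  have hhigh : D.effCdf t C = 1 := by
    rw [hD.effCdf_eq, measureReal_def]
    have : D.shockLaw {s | effRenewable t s ≤ C} = 1 := by
      refine prob_compl_eq_zero_iff₀ ?_ |>.1 ?_
      · exact (measurable_effRenewable t measurableSet_Iic).nullMeasurableSet
      · filter_upwards [hC t] with s hs using (abs_le.1 hs).2
    simp [this]
  have hcont := hD.continuous_effCdf t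
  have hmono : Monotone (D.effCdf t) := monotone_cdf _
  have hne : ∃ z, D.effCdf t z = a := by
    have := intermediate_value_Icc (f := D.effCdf t) (a := -C - 1) (b := C) (by linarith)
      hcont.continuousOn
    rw [hlow, hhigh] at this
    obtain ⟨z, -, hz⟩ := this ⟨h0, h1⟩
    exact ⟨z, hz⟩
  have hclosed : IsClosed {z | D.effCdf t z = a} := isClosed_eq hcont continuous_const
  unfold effQuantile
  split_ifs with ha
  · subst ha
    refine hclosed.csSup_mem hne ⟨C, fun z hz => ?_⟩
    by_contra! h
    have := hmono h.le
    rw [hhigh, hz] at this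
    norm_num at this
  · refine hclosed.csInf_mem hne ⟨-C - 1, fun z hz => ?_⟩
    by_contra! h
    have := hmono h.le
    rw [hlow, hz] at this
    exact ha (le_antisymm this h0)

/-- The positive part has the indicator of `[0, ∞)` as a subgradient; taking expectations turns the
indicator into the c.d.f. of `Z t`. -/
lemma expDeficit_subgradient (hD : D.Assumptions) (hP : D.P.Nonempty) (t : Fin T) (l l' : ℝ) :
    D.expDeficit t l + (l' - l) * D.effCdf t l ≤ D.expDeficit t l' := by
  have := hD.prob_shock
  have hm : MeasurableSet {s : (Fin T → ℝ) × (Fin N → Fin T → ℝ) | effRenewable t s ≤ l} :=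
    measurable_effRenewable t measurableSet_Iic
  have hi : Integrable ({s | effRenewable t s ≤ l}.indicator fun _ => (l' - l)) D.shockLaw :=
    (integrable_const _).indicator hm
  have h1 : (l' - l) * D.effCdf t l
      = ∫ s, {s | effRenewable t s ≤ l}.indicator (fun _ => (l' - l)) s ∂D.shockLaw := by
    rw [integral_indicator_const _ hm, ← hD.effCdf_eq, smul_eq_mul, mul_comm]
  unfold expDeficit
  rw [h1, ← integral_add (hD.integrable_deficit hP t l) hi]
  refine integral_mono ((hD.integrable_deficit hP t l).add hi) (hD.integrable_deficit hP t l')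
    fun s => ?_
  simp only [Set.indicator_apply, Set.mem_ofPred_eq]
  split_ifs with h
  · rw [max_eq_left (by linarith)]
    exact le_max_of_le_left (by linarith)
  · rw [max_eq_right (by linarith)]
    simp

/-- The newsvendor rule minimizes the expected cost. -/
lemma expCost_optBase_le (hD : D.Assumptions) (hP : D.P.Nonempty) (j : Fin M) (t : Fin T)
    (L : ℝ) {B : ℝ} (hB : 0 ≤ B) :
    D.expCost j t L (D.optBase j t L) ≤ D.expCost j t L B := by
  have hα := (hD.alphaBar_bounds j t).1
  have hβ := (hD.beta_bounds j t).1
  set b := D.optBase j t L with hb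
  have hsub := mul_le_mul_of_nonneg_left (hD.expDeficit_subgradient hP t (L - b) (L - B)) hα
  -- By convexity the cost at `B` exceeds the cost at `b` by at least this product. Its second
  -- factor is the slope of the cost at `b`: it vanishes when the quantile determines `b`, and is
  -- nonnegative when `b = 0`.
  suffices h : 0 ≤ (B - b) * (D.beta j t - D.alphaBar j t * D.effCdf t (L - b)) by
    unfold expCost
    nlinarith
  have hmono : Monotone (D.effCdf t) := monotone_cdf _
  have hF1 : D.effCdf t (L - b) ≤ 1 := cdf_le_one _ _
  unfold optBase at hb
  split_ifs at hb with hlt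
  · rw [hb, sub_zero]
    rw [hb] at hF1
    exact mul_nonneg hB (by nlinarith)
  · push Not at hlt
    have hq := hD.effCdf_effQuantile hP t (a := D.beta j t / D.alphaBar j t) (by positivity)
      (div_le_one_of_le₀ hlt hα)
    have hmul : D.alphaBar j t * (D.beta j t / D.alphaBar j t) = D.beta j t := by
      -- If `alphaBar = 0`, then `beta = 0` in this branch, and the quotient `0 / 0` is `0`.
      rcases hα.eq_or_lt with h | h
      · rw [← h] at hlt ⊢
        rw [zero_mul, le_antisymm hlt hβ]
      · field_simp
    rcases le_total (D.effQuantile t (D.beta j t / D.alphaBar j t)) L with h | h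
    · rw [max_eq_left (by linarith)] at hb
      rw [hb, sub_sub_cancel, hq, hmul, sub_self, mul_zero]
    · rw [max_eq_right (by linarith)] at hb
      rw [hb, sub_zero, sub_zero]
      refine mul_nonneg hB ?_
      have := mul_le_mul_of_nonneg_left (hmono h) hα
      rw [hq, hmul] at this
      linarith

end Assumptions

end Model

end SmartGrid

/-! ### Independence of the history from the prices and shocks of the day. -/

namespace SmartGrid

/-- The hypotheses make the joint law of `f`, `g`, `h` a triple product, which is then regrouped by
associativity. -/
lemma indepFun_prodMk_of_indepFun {Ω α β γ : Type*} [MeasurableSpace Ω] [MeasurableSpace α]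
    [MeasurableSpace β] [MeasurableSpace γ] {μ : Measure Ω} [IsProbabilityMeasure μ]
    {f : Ω → α} {g : Ω → β} {h : Ω → γ} (hf : Measurable f) (hg : Measurable g) (hh : Measurable h)
    (hfgh : IndepFun f (fun ω => (g ω, h ω)) μ) (hgh : IndepFun g h μ) :
    IndepFun (fun ω => (f ω, g ω)) h μ := by
  have hfg : IndepFun f g μ := hfgh.comp measurable_id measurable_fst
  rw [indepFun_iff_map_prod_eq_prod_map_map hf.aemeasurable (hg.prodMk hh).aemeasurable,
    (indepFun_iff_map_prod_eq_prod_map_map hg.aemeasurable hh.aemeasurable).1 hgh] at hfgh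
  rw [indepFun_iff_map_prod_eq_prod_map_map (hf.prodMk hg).aemeasurable hh.aemeasurable,
    (indepFun_iff_map_prod_eq_prod_map_map hf.aemeasurable hg.aemeasurable).1 hfg]
  have := Measure.isProbabilityMeasure_map (μ := μ) hf.aemeasurable
  have := Measure.isProbabilityMeasure_map (μ := μ) hg.aemeasurable
  have := Measure.isProbabilityMeasure_map (μ := μ) hh.aemeasurable
  have key := congrArg (Measure.map MeasurableEquiv.prodAssoc.symm) hfgh
  rw [Measure.map_map MeasurableEquiv.prodAssoc.symm.measurable (by fun_prop)] at key
  rw [← (measurePreserving_prodAssoc (μ.map f) (μ.map g) (μ.map h)).symm.map_eq]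
  exact key

namespace Model

variable {N T M : ℕ} {D : Model N T M}

/-- Welfare of one day, given the index `j` of the market price pair, the real-time prices `α`, the
announced prices `p`, the base powers `b` and the shocks `s`. -/
noncomputable def dayWelfare (D : Model N T M) (j : Fin M) (α p b : Fin T → ℝ)
    (s : (Fin T → ℝ) × (Fin N → Fin T → ℝ)) : ℝ :=
  ∑ t, (∑ n, D.U n t (D.plannedLoad n t (p t) + s.2 n t) -
    (D.beta j t * b t +
      α t * max (∑ n, (D.plannedLoad n t (p t) + s.2 n t) - b t - s.1 t) 0))

/-- The values of the data of the days before `k` and of the randomization variable of day `k`. -/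
abbrev History (N T M k : ℕ) : Type :=
  (Finset.range k → Fin M × (Fin T → ℝ) × (Fin T → ℝ) × (Fin N → Fin T → ℝ) × ℝ) × ℝ

lemma sum_load_sub (p : ℝ) (t : Fin T) (b : ℝ) (s : (Fin T → ℝ) × (Fin N → Fin T → ℝ)) :
    ∑ n, (D.plannedLoad n t p + s.2 n t) - b - s.1 t
      = D.totalPlannedLoad t p - b - effRenewable t s := by
  simp only [effRenewable, totalPlannedLoad, Finset.sum_add_distrib]
  ring

namespace Realization

variable {Ω : Type*} [MeasurableSpace Ω] {μ : Measure Ω} (S : D.Realization μ)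

def shock (k : ℕ) (ω : Ω) : (Fin T → ℝ) × (Fin N → Fin T → ℝ) := (S.renewable k ω, S.noise k ω)

def history (k : ℕ) (ω : Ω) : History N T M k :=
  (fun i => (S.market i ω, S.rtPrice i ω, S.renewable i ω, S.noise i ω, S.seed i ω), S.seed k ω)

lemma measurable_shock (k : ℕ) : Measurable (S.shock k) :=
  (S.measurable_renewable k).prodMk (S.measurable_noise k)

lemma measurable_day (k : ℕ) : Measurable fun ω =>
    (S.market k ω, S.rtPrice k ω, S.renewable k ω, S.noise k ω, S.seed k ω) :=
  (S.measurable_market k).prodMk ((S.measurable_rtPrice k).prodMk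
    ((S.measurable_renewable k).prodMk ((S.measurable_noise k).prodMk (S.measurable_seed k))))

lemma measurable_history (k : ℕ) : Measurable (S.history k) :=
  Measurable.prodMk (measurable_pi_lambda _ fun i : Finset.range k => S.measurable_day i)
    (S.measurable_seed k)

lemma measurable_prices (k : ℕ) : Measurable fun ω => (S.market k ω, S.rtPrice k ω) :=
  (S.measurable_market k).prodMk (S.measurable_rtPrice k)

section Indep

variable [IsProbabilityMeasure μ]

/-- Earlier days are independent of day `k`, and within day `k` the seed is independent of the rest.
The price pair of day `k` is kept out of the history because the real-time prices may depend on it.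
-/
lemma indepFun_history (k : ℕ) :
    IndepFun (S.history k) (fun ω => (S.shock k ω, (S.market k ω, S.rtPrice k ω))) μ := by
  have h1 := S.indep_days.indepFun_finset (Finset.range k) {k} (by simp)
    (fun i => S.measurable_day i)
  have h2 : IndepFun (fun ω (i : Finset.range k) =>
      (S.market i ω, S.rtPrice i ω, S.renewable i ω, S.noise i ω, S.seed i ω))
      (fun ω => (S.seed k ω, (S.shock k ω, (S.market k ω, S.rtPrice k ω)))) μ := by
    have hm : Measurable fun x : ({k} : Finset ℕ) →
        Fin M × (Fin T → ℝ) × (Fin T → ℝ) × (Fin N → Fin T → ℝ) × ℝ =>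
        ((x ⟨k, by simp⟩).2.2.2.2, (((x ⟨k, by simp⟩).2.2.1, (x ⟨k, by simp⟩).2.2.2.1),
          ((x ⟨k, by simp⟩).1, (x ⟨k, by simp⟩).2.1))) := by fun_prop
    exact h1.comp measurable_id hm
  have h3 : IndepFun (S.seed k) (fun ω => (S.shock k ω, (S.market k ω, S.rtPrice k ω))) μ := by
    have hm : Measurable fun x : Fin M × (Fin T → ℝ) × (Fin T → ℝ) × (Fin N → Fin T → ℝ) =>
        ((x.2.2.1, x.2.2.2), (x.1, x.2.1)) := by fun_prop
    exact (S.indep_seed k).comp measurable_id hm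
  exact indepFun_prodMk_of_indepFun (measurable_pi_lambda _ fun i => S.measurable_day i)
    (S.measurable_seed k) ((S.measurable_shock k).prodMk (S.measurable_prices k)) h2 h3

lemma indepFun_history_shock (k : ℕ) : IndepFun (S.history k) (S.shock k) μ :=
  (S.indepFun_history k).comp measurable_id measurable_fst

lemma indepFun_history_shock_prices (k : ℕ) :
    IndepFun (fun ω => (S.history k ω, S.shock k ω))
      (fun ω => (S.market k ω, S.rtPrice k ω)) μ :=
  indepFun_prodMk_of_indepFun (S.measurable_history k) (S.measurable_shock k)
    (S.measurable_prices k) (S.indepFun_history k) (S.indep_market_shock k).symm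

variable {S} {k : ℕ} {V : History N T M k × ((Fin T → ℝ) × (Fin N → Fin T → ℝ)) → ℝ}

lemma integrable_prod_history_shock (hV : Measurable V)
    (hVi : Integrable (fun ω => V (S.history k ω, S.shock k ω)) μ) :
    Integrable V ((μ.map (S.history k)).prod D.shockLaw) := by
  have h := (indepFun_iff_map_prod_eq_prod_map_map (S.measurable_history k).aemeasurable
    (S.measurable_shock k).aemeasurable).1 (S.indepFun_history_shock k)
  have h' : μ.map (S.shock k) = D.shockLaw := S.shock_law k
  rw [h'] at h
  rw [← h]
  exact (integrable_map_measure hV.aestronglyMeasurable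
    ((S.measurable_history k).prodMk (S.measurable_shock k)).aemeasurable).2 hVi

lemma isProbabilityMeasure_shockLaw (S : D.Realization μ) : IsProbabilityMeasure D.shockLaw := by
  have h : μ.map (S.shock 0) = D.shockLaw := S.shock_law 0
  rw [← h]
  exact Measure.isProbabilityMeasure_map (S.measurable_shock 0).aemeasurable

lemma integrable_integral_shock (hV : Measurable V)
    (hVi : Integrable (fun ω => V (S.history k ω, S.shock k ω)) μ) :
    Integrable (fun ω => ∫ s, V (S.history k ω, s) ∂D.shockLaw) μ := by
  have := S.isProbabilityMeasure_shockLaw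
  exact (integrable_prod_history_shock hV hVi).integral_prod_left.comp_measurable
    (S.measurable_history k)

lemma integral_history_shock (hV : Measurable V)
    (hVi : Integrable (fun ω => V (S.history k ω, S.shock k ω)) μ) :
    ∫ ω, V (S.history k ω, S.shock k ω) ∂μ
      = ∫ ω, ∫ s, V (S.history k ω, s) ∂D.shockLaw ∂μ := by
  have := S.isProbabilityMeasure_shockLaw
  have := Measure.isProbabilityMeasure_map (μ := μ) (S.measurable_history k).aemeasurable
  have h := (indepFun_iff_map_prod_eq_prod_map_map (S.measurable_history k).aemeasurable
    (S.measurable_shock k).aemeasurable).1 (S.indepFun_history_shock k)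
  have h' : μ.map (S.shock k) = D.shockLaw := S.shock_law k
  rw [h'] at h
  have hi := integrable_prod_history_shock hV hVi
  rw [← integral_map ((S.measurable_history k).prodMk (S.measurable_shock k)).aemeasurable
    hV.aestronglyMeasurable, h, integral_prod V hi,
    integral_map (S.measurable_history k).aemeasurable
      hi.integral_prod_left.aestronglyMeasurable]

lemma integrable_mul_history_shock {φ : Fin M × (Fin T → ℝ) → ℝ} (hφ : Measurable φ)
    (hφi : Integrable (fun ω => φ (S.market k ω, S.rtPrice k ω)) μ) (hV : Measurable V)
    (hVi : Integrable (fun ω => V (S.history k ω, S.shock k ω)) μ) :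
    Integrable (fun ω => φ (S.market k ω, S.rtPrice k ω) * V (S.history k ω, S.shock k ω)) μ :=
  ((S.indepFun_history_shock_prices k).comp hV hφ).symm.integrable_mul hφi hVi

/-- Prices, history and shocks of a day can be averaged one after the other. -/
lemma integral_mul_history_shock {φ : Fin M × (Fin T → ℝ) → ℝ} (hφ : Measurable φ)
    (hφi : Integrable (fun ω => φ (S.market k ω, S.rtPrice k ω)) μ) (hV : Measurable V)
    (hVi : Integrable (fun ω => V (S.history k ω, S.shock k ω)) μ) :
    ∫ ω, φ (S.market k ω, S.rtPrice k ω) * V (S.history k ω, S.shock k ω) ∂μ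
      = (∫ ω, φ (S.market k ω, S.rtPrice k ω) ∂μ)
        * ∫ ω, ∫ s, V (S.history k ω, s) ∂D.shockLaw ∂μ := by
  rw [← integral_history_shock hV hVi]
  exact ((S.indepFun_history_shock_prices k).comp hV hφ).symm.integral_mul_eq_mul_integral
    hφi.aestronglyMeasurable hVi.aestronglyMeasurable

omit [IsProbabilityMeasure μ] in
lemma ae_shock {q : (Fin T → ℝ) × (Fin N → Fin T → ℝ) → Prop} (S : D.Realization μ) (k : ℕ)
    (h : ∀ᵐ s ∂D.shockLaw, q s) : ∀ᵐ ω ∂μ, q (S.shock k ω) := by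
  have h' : μ.map (S.shock k) = D.shockLaw := S.shock_law k
  rw [← h'] at h
  exact ae_of_ae_map (S.measurable_shock k).aemeasurable h

end Indep

end Realization

end Model

end SmartGrid

/-! ### Expected welfare and expected loads of one day. -/

namespace SmartGrid

lemma integrable_fun_sub {α : Type*} [MeasurableSpace α] {ν : Measure α} {f g : α → ℝ}
    (hf : Integrable f ν) (hg : Integrable g ν) : Integrable (fun a => f a - g a) ν :=
  hf.sub hg

namespace Model

variable {N T M : ℕ} {D : Model N T M}

/-- Expected welfare of one day at the announced prices `p` and base powers `b`, when the market
price pair is the `j`-th one. -/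
noncomputable def expWelfare (D : Model N T M) (j : Fin M) (p b : Fin T → ℝ) : ℝ :=
  ∑ t, (D.meanUtility t (p t) - D.expCost j t (D.totalPlannedLoad t (p t)) (b t))

/-- Utility of all users in slot `t` at price `x`, minus the payment for the base power `y`. -/
noncomputable def slotGain (D : Model N T M) (j : Fin M) (t : Fin T) (x y : ℝ)
    (s : (Fin T → ℝ) × (Fin N → Fin T → ℝ)) : ℝ :=
  ∑ n, D.U n t (D.plannedLoad n t x + s.2 n t) - D.beta j t * y

/-- Power deficit in slot `t` at price `x` with base power `y`. -/
noncomputable def slotDeficit (D : Model N T M) (t : Fin T) (x y : ℝ)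
    (s : (Fin T → ℝ) × (Fin N → Fin T → ℝ)) : ℝ :=
  max (D.totalPlannedLoad t x - y - effRenewable t s) 0

lemma Assumptions.exists_utility_bound (hD : D.Assumptions) (hP : D.P.Nonempty) (n : Fin N)
    (t : Fin T) : ∃ K, ∀ᵐ s ∂D.shockLaw, ∀ p, |D.U n t (D.plannedLoad n t p + s.2 n t)| ≤ K := by
  have := hD.prob_shock
  obtain ⟨C, -, hC⟩ := hD.exists_noise_bound hP
  obtain ⟨R, -, hR⟩ := hD.exists_plannedLoad_bound hP
  obtain ⟨K, hK⟩ := exists_bound_comp_add (hD.U_cont n t) (hC n t) R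
  refine ⟨K, ?_⟩
  filter_upwards [hK] with s hs p
  exact hs _ (hR n t p)

lemma Assumptions.integrable_utility (hD : D.Assumptions) (hP : D.P.Nonempty) (n : Fin N)
    (t : Fin T) (L : ℝ) : Integrable (fun s => D.U n t (L + s.2 n t)) D.shockLaw := by
  have := hD.prob_shock
  obtain ⟨C, -, hC⟩ := hD.exists_noise_bound hP
  exact integrable_comp_add (hD.U_cont n t) (measurable_noise_coord n t) (hC n t) L

namespace Realization

variable {Ω : Type*} [MeasurableSpace Ω] {μ : Measure Ω} [IsProbabilityMeasure μ]
  {S : D.Realization μ} {k : ℕ}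

lemma measurable_marketIndicator (j : Fin M) :
    Measurable fun x : Fin M × (Fin T → ℝ) => if x.1 = j then (1 : ℝ) else 0 :=
  Measurable.ite (measurable_fst (measurableSet_singleton j)) measurable_const measurable_const

lemma measurable_priceIndicator (j : Fin M) (t : Fin T) :
    Measurable fun x : Fin M × (Fin T → ℝ) => if x.1 = j then x.2 t else 0 :=
  Measurable.ite (measurable_fst (measurableSet_singleton j))
    ((measurable_pi_apply t).comp measurable_snd) measurable_const

lemma integrable_marketIndicator (j : Fin M) :
    Integrable (fun ω => if S.market k ω = j then (1 : ℝ) else 0) μ := by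
  refine Integrable.of_bound
    ((measurable_marketIndicator j).comp (S.measurable_prices k)).aestronglyMeasurable 1
    (Eventually.of_forall fun ω => ?_)
  split_ifs <;> simp

lemma integrable_priceIndicator (j : Fin M) (t : Fin T) :
    Integrable (fun ω => if S.market k ω = j then S.rtPrice k ω t else 0) μ := by
  refine Integrable.of_bound
    ((measurable_priceIndicator j t).comp (S.measurable_prices k)).aestronglyMeasurable |D.alphaMax|
    ?_
  filter_upwards [S.rtPrice_bounds k t] with ω h
  split_ifs
  · exact abs_le_abs_of_nonneg h.1 h.2
  · simp

omit [IsProbabilityMeasure μ] in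
lemma integral_marketIndicator (j : Fin M) :
    ∫ ω, (if S.market k ω = j then (1 : ℝ) else 0) ∂μ = D.marketProb j := by
  have hm : MeasurableSet (S.market k ⁻¹' {j}) :=
    S.measurable_market k (measurableSet_singleton j)
  rw [← S.market_law k j, ← integral_indicator_one hm]
  congr 1
  ext ω
  by_cases h : S.market k ω = j <;> simp [h]

omit [IsProbabilityMeasure μ] in
lemma integral_priceIndicator (j : Fin M) (t : Fin T) :
    ∫ ω, (if S.market k ω = j then S.rtPrice k ω t else 0) ∂μ
      = D.marketProb j * D.alphaBar j t := by
  have hm : MeasurableSet (S.market k ⁻¹' {j}) :=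
    S.measurable_market k (measurableSet_singleton j)
  rw [← S.rtPrice_mean k j t, ← integral_indicator hm]
  congr 1
  ext ω
  by_cases h : S.market k ω = j <;> simp [h]

section DayFormula

variable {p b : Fin M → History N T M k → Fin T → ℝ} {C : ℝ}

lemma measurable_planned_comp (hD : D.Assumptions) (hP : D.P.Nonempty)
    (hp : ∀ j, Measurable (p j)) (j : Fin M) (n : Fin N) (t : Fin T) :
    Measurable fun h => D.plannedLoad n t (p j h t) :=
  (hD.measurable_plannedLoad hP n t).comp ((measurable_pi_apply t).comp (hp j))

lemma measurable_utility_part (hD : D.Assumptions) (hP : D.P.Nonempty)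
    (hp : ∀ j, Measurable (p j)) (hb : ∀ j, Measurable (b j)) (j : Fin M) (t : Fin T) :
    Measurable fun x : History N T M k × ((Fin T → ℝ) × (Fin N → Fin T → ℝ)) =>
      D.slotGain j t (p j x.1 t) (b j x.1 t) x.2 := by
  refine (Finset.measurable_sum _ fun n _ => (hD.U_cont n t).measurable.comp ?_).sub ?_
  · exact ((measurable_planned_comp hD hP hp j n t).comp measurable_fst).add
      ((measurable_noise_coord n t).comp measurable_snd)
  · exact (((measurable_pi_apply t).comp (hb j)).comp measurable_fst).const_mul _

lemma measurable_deficit_part (hD : D.Assumptions) (hP : D.P.Nonempty)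
    (hp : ∀ j, Measurable (p j)) (hb : ∀ j, Measurable (b j)) (j : Fin M) (t : Fin T) :
    Measurable fun x : History N T M k × ((Fin T → ℝ) × (Fin N → Fin T → ℝ)) =>
      D.slotDeficit t (p j x.1 t) (b j x.1 t) x.2 := by
  refine ((Measurable.sub ?_ ?_).sub ((measurable_effRenewable t).comp measurable_snd)).max
    measurable_const
  · exact (Finset.measurable_sum _ fun n _ => measurable_planned_comp hD hP hp j n t).comp
      measurable_fst
  · exact ((measurable_pi_apply t).comp (hb j)).comp measurable_fst

lemma integrable_utility_part (hD : D.Assumptions) (hP : D.P.Nonempty)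
    (hp : ∀ j, Measurable (p j)) (hb : ∀ j, Measurable (b j)) (hbC : ∀ j h t, |b j h t| ≤ C)
    (j : Fin M) (t : Fin T) :
    Integrable (fun ω => D.slotGain j t (p j (S.history k ω) t) (b j (S.history k ω) t)
      (S.shock k ω)) μ := by
  refine Integrable.sub (integrable_finsetSum _ fun n _ => ?_) (Integrable.const_mul ?_ _)
  · obtain ⟨K, hK⟩ := hD.exists_utility_bound hP n t
    refine Integrable.of_bound ((hD.U_cont n t).measurable.comp
      (((measurable_planned_comp hD hP hp j n t).comp (S.measurable_history k)).add
      ((measurable_noise_coord n t).comp (S.measurable_shock k)))).aestronglyMeasurable K ?_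
    filter_upwards [S.ae_shock k hK] with ω h
    exact h _
  · exact Integrable.of_bound (((measurable_pi_apply t).comp (hb j)).comp
      (S.measurable_history k)).aestronglyMeasurable C (Eventually.of_forall fun ω => hbC j _ t)

lemma integrable_deficit_part (hD : D.Assumptions) (hP : D.P.Nonempty)
    (hp : ∀ j, Measurable (p j)) (hb : ∀ j, Measurable (b j)) (hbC : ∀ j h t, |b j h t| ≤ C)
    (j : Fin M) (t : Fin T) :
    Integrable (fun ω => D.slotDeficit t (p j (S.history k ω) t) (b j (S.history k ω) t)
      (S.shock k ω)) μ := by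
  obtain ⟨R, -, hR⟩ := hD.exists_totalPlannedLoad_bound hP
  obtain ⟨Q, -, hQ⟩ := hD.exists_effRenewable_bound hP
  refine Integrable.of_bound ((measurable_deficit_part hD hP hp hb j t).comp
    ((S.measurable_history k).prodMk (S.measurable_shock k))).aestronglyMeasurable (R + C + Q) ?_
  filter_upwards [S.ae_shock k (hQ t)] with ω h
  rw [Real.norm_eq_abs, abs_of_nonneg (le_max_right _ _)]
  have h1 := abs_le.1 (hR t (p j (S.history k ω) t))
  have h2 := abs_le.1 (hbC j (S.history k ω) t)
  have h3 := abs_le.1 h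
  exact max_le (by linarith) (by linarith)

-- Fixing the value `j` of the pair turns the decisions into functions of the history alone. Each
-- term is then built from products of a function of the market prices and a function of history and
-- shock, to which independence applies.
omit [IsProbabilityMeasure μ] in
lemma dayWelfare_eq_sum (S : D.Realization μ) (k : ℕ)
    (p b : Fin M → History N T M k → Fin T → ℝ) (ω : Ω) :
    D.dayWelfare (S.market k ω) (S.rtPrice k ω) (p (S.market k ω) (S.history k ω))
      (b (S.market k ω) (S.history k ω)) (S.shock k ω)
    = ∑ j, ∑ t, ((if S.market k ω = j then (1 : ℝ) else 0) *
        D.slotGain j t (p j (S.history k ω) t) (b j (S.history k ω) t) (S.shock k ω)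
        - (if S.market k ω = j then S.rtPrice k ω t else 0) *
          D.slotDeficit t (p j (S.history k ω) t) (b j (S.history k ω) t) (S.shock k ω)) := by
  rw [Finset.sum_eq_single (S.market k ω)]
  · unfold dayWelfare
    refine Finset.sum_congr rfl fun t _ => ?_
    rw [sum_load_sub]
    simp only [if_true, slotGain, slotDeficit]
    ring
  · intro j _ hj
    simp [hj.symm]
  · simp

lemma integrable_dayWelfare (hD : D.Assumptions) (hP : D.P.Nonempty)
    (hp : ∀ j, Measurable (p j)) (hb : ∀ j, Measurable (b j)) (hbC : ∀ j h t, |b j h t| ≤ C) :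
    Integrable (fun ω => D.dayWelfare (S.market k ω) (S.rtPrice k ω)
      (p (S.market k ω) (S.history k ω)) (b (S.market k ω) (S.history k ω)) (S.shock k ω)) μ := by
  simp_rw [dayWelfare_eq_sum S k p b]
  refine integrable_finsetSum _ fun j _ => integrable_finsetSum _ fun t _ => ?_
  exact (integrable_mul_history_shock (measurable_marketIndicator j) (integrable_marketIndicator j)
    (measurable_utility_part hD hP hp hb j t) (integrable_utility_part hD hP hp hb hbC j t)).sub
    (integrable_mul_history_shock (measurable_priceIndicator j t) (integrable_priceIndicator j t)
    (measurable_deficit_part hD hP hp hb j t) (integrable_deficit_part hD hP hp hb hbC j t))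

lemma integral_utility_part (hD : D.Assumptions) (hP : D.P.Nonempty) (j : Fin M) (t : Fin T)
    (x y : ℝ) : ∫ s, D.slotGain j t x y s ∂D.shockLaw
      = D.meanUtility t x - D.beta j t * y := by
  have := hD.prob_shock
  have hi := fun n => hD.integrable_utility hP n t (D.plannedLoad n t x)
  unfold slotGain
  rw [integral_sub (integrable_finsetSum _ fun n _ => hi n) (integrable_const _),
    integral_finsetSum _ fun n _ => hi n]
  simp [meanUtility]

/-- The indicator of the pair `j` has mean `marketProb j`, and its product with the real-time price
has mean `marketProb j * alphaBar j t`; so the random price may be replaced by its conditional mean.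
-/
lemma integral_dayWelfare (hD : D.Assumptions) (hP : D.P.Nonempty)
    (hp : ∀ j, Measurable (p j)) (hb : ∀ j, Measurable (b j)) (hbC : ∀ j h t, |b j h t| ≤ C) :
    ∫ ω, D.dayWelfare (S.market k ω) (S.rtPrice k ω)
      (p (S.market k ω) (S.history k ω)) (b (S.market k ω) (S.history k ω)) (S.shock k ω) ∂μ
    = ∑ j, D.marketProb j *
        ∫ ω, D.expWelfare j (p j (S.history k ω)) (b j (S.history k ω)) ∂μ := by
  simp_rw [dayWelfare_eq_sum S k p b]
  have hu : ∀ j t, Integrable (fun ω => (if S.market k ω = j then (1 : ℝ) else 0) *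
      D.slotGain j t (p j (S.history k ω) t) (b j (S.history k ω) t) (S.shock k ω)) μ :=
    fun j t => integrable_mul_history_shock (measurable_marketIndicator j)
    (integrable_marketIndicator (S := S) (k := k) j)
    (measurable_utility_part hD hP hp hb j t) (integrable_utility_part hD hP hp hb hbC j t)
  have hd : ∀ j t, Integrable (fun ω => (if S.market k ω = j then S.rtPrice k ω t else 0) *
      D.slotDeficit t (p j (S.history k ω) t) (b j (S.history k ω) t) (S.shock k ω)) μ :=
    fun j t => integrable_mul_history_shock (measurable_priceIndicator j t)
    (integrable_priceIndicator (S := S) (k := k) j t)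
    (measurable_deficit_part hD hP hp hb j t) (integrable_deficit_part hD hP hp hb hbC j t)
  rw [integral_finsetSum _ fun j _ => integrable_finsetSum _ fun t _ => integrable_fun_sub (hu j t) (hd j t)]
  refine Finset.sum_congr rfl fun j _ => ?_
  have hu' : ∀ t, Integrable (fun ω => ∫ s, D.slotGain j t (p j (S.history k ω) t)
      (b j (S.history k ω) t) s ∂D.shockLaw) μ := fun t => integrable_integral_shock (S := S)
    (measurable_utility_part hD hP hp hb j t) (integrable_utility_part hD hP hp hb hbC j t)
  have hd' : ∀ t, Integrable (fun ω => ∫ s, D.slotDeficit t (p j (S.history k ω) t)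
      (b j (S.history k ω) t) s ∂D.shockLaw) μ := fun t => integrable_integral_shock (S := S)
    (measurable_deficit_part hD hP hp hb j t) (integrable_deficit_part hD hP hp hb hbC j t)
  have hexp : ∀ ω, D.expWelfare j (p j (S.history k ω)) (b j (S.history k ω))
      = ∑ t, (∫ s, D.slotGain j t (p j (S.history k ω) t) (b j (S.history k ω) t) s ∂D.shockLaw
        - D.alphaBar j t *
          ∫ s, D.slotDeficit t (p j (S.history k ω) t) (b j (S.history k ω) t) s ∂D.shockLaw) := by
    intro ω
    refine Finset.sum_congr rfl fun t _ => ?_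
    rw [integral_utility_part hD hP]
    unfold expCost expDeficit slotDeficit
    ring
  simp_rw [hexp]
  rw [integral_finsetSum _ fun t _ => integrable_fun_sub (hu j t) (hd j t),
    integral_finsetSum _ fun t _ => integrable_fun_sub (hu' t) ((hd' t).const_mul _), Finset.mul_sum]
  refine Finset.sum_congr rfl fun t _ => ?_
  have h1 := integral_mul_history_shock (measurable_marketIndicator j)
    (integrable_marketIndicator (S := S) (k := k) j) (measurable_utility_part hD hP hp hb j t)
    (integrable_utility_part hD hP hp hb hbC j t)
  have h2 := integral_mul_history_shock (measurable_priceIndicator j t)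
    (integrable_priceIndicator (S := S) (k := k) j t) (measurable_deficit_part hD hP hp hb j t)
    (integrable_deficit_part hD hP hp hb hbC j t)
  dsimp only at h1 h2
  rw [integral_sub (hu j t) (hd j t), integral_sub (hu' t) ((hd' t).const_mul _),
    integral_const_mul, h1, h2, integral_marketIndicator, integral_priceIndicator]
  ring

lemma integrable_planned_history (hD : D.Assumptions) (hP : D.P.Nonempty)
    (hp : ∀ j, Measurable (p j)) (j : Fin M) (n : Fin N) (t : Fin T) :
    Integrable (fun ω => D.plannedLoad n t (p j (S.history k ω) t)) μ := by
  obtain ⟨R, -, hR⟩ := hD.exists_plannedLoad_bound hP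
  exact Integrable.of_bound ((measurable_planned_comp hD hP hp j n t).comp
    (S.measurable_history k)).aestronglyMeasurable R (Eventually.of_forall fun ω => hR n t _)

lemma integrable_expWelfare (hD : D.Assumptions) (hP : D.P.Nonempty)
    (hp : ∀ j, Measurable (p j)) (hb : ∀ j, Measurable (b j)) (hbC : ∀ j h t, |b j h t| ≤ C)
    (j : Fin M) :
    Integrable (fun ω => D.expWelfare j (p j (S.history k ω)) (b j (S.history k ω))) μ := by
  have hu' : ∀ t, Integrable (fun ω => ∫ s, D.slotGain j t (p j (S.history k ω) t)
      (b j (S.history k ω) t) s ∂D.shockLaw) μ := fun t => integrable_integral_shock (S := S)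
    (measurable_utility_part hD hP hp hb j t) (integrable_utility_part hD hP hp hb hbC j t)
  have hd' : ∀ t, Integrable (fun ω => ∫ s, D.slotDeficit t (p j (S.history k ω) t)
      (b j (S.history k ω) t) s ∂D.shockLaw) μ := fun t => integrable_integral_shock (S := S)
    (measurable_deficit_part hD hP hp hb j t) (integrable_deficit_part hD hP hp hb hbC j t)
  refine (integrable_finsetSum Finset.univ fun t _ =>
    integrable_fun_sub (hu' t) ((hd' t).const_mul (D.alphaBar j t))).congr (Eventually.of_forall fun ω => ?_)
  refine Finset.sum_congr rfl fun t _ => ?_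
  rw [integral_utility_part hD hP]
  unfold expCost expDeficit slotDeficit
  ring

lemma integral_load (hD : D.Assumptions) (hP : D.P.Nonempty)
    (hp : ∀ j, Measurable (p j)) (n : Fin N) (t : Fin T) :
    ∫ ω, (D.plannedLoad n t (p (S.market k ω) (S.history k ω) t) + S.noise k ω n t) ∂μ
      = ∑ j, D.marketProb j * ∫ ω, D.plannedLoad n t (p j (S.history k ω) t) ∂μ := by
  have := hD.prob_shock
  have hshock : μ.map (S.shock k) = D.shockLaw := S.shock_law k
  have hnoise : Integrable (fun ω => S.noise k ω n t) μ := by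
    have h := hD.integrable_noise hP n t
    rw [← hshock] at h
    exact h.comp_measurable (S.measurable_shock k)
  have hnoise0 : ∫ ω, S.noise k ω n t ∂μ = 0 := by
    rw [← hD.w_mean n t, ← hshock, integral_map (S.measurable_shock k).aemeasurable
      (measurable_noise_coord n t).aestronglyMeasurable]
    rfl
  have hm := fun j => (measurable_planned_comp hD hP hp j n t).comp
    (measurable_fst : Measurable
      (Prod.fst : History N T M k × ((Fin T → ℝ) × (Fin N → Fin T → ℝ)) → History N T M k))
  have hi := fun j => integrable_planned_history (S := S) hD hP hp j n t
  have hsum : ∀ ω, D.plannedLoad n t (p (S.market k ω) (S.history k ω) t)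
      = ∑ j, (if S.market k ω = j then (1 : ℝ) else 0) *
        D.plannedLoad n t (p j (S.history k ω) t) := by
    intro ω
    simp
  have hprod : ∀ j, Integrable (fun ω => (if S.market k ω = j then (1 : ℝ) else 0) *
      D.plannedLoad n t (p j (S.history k ω) t)) μ := fun j => integrable_mul_history_shock (measurable_marketIndicator j)
    (integrable_marketIndicator (S := S) (k := k) j) (hm j) (hi j)
  simp_rw [hsum]
  rw [integral_add (integrable_finsetSum _ fun j _ => hprod j) hnoise, hnoise0, add_zero,
    integral_finsetSum _ fun j _ => hprod j]
  refine Finset.sum_congr rfl fun j _ => ?_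
  refine (integral_mul_history_shock (measurable_marketIndicator j)
    (integrable_marketIndicator (S := S) (k := k) j) (hm j) (hi j)).trans ?_
  rw [integral_marketIndicator]
  simp

end DayFormula

end Realization

end Model

end SmartGrid

/-! ### One-day outcomes of a policy as points of closed convex hulls. -/

namespace SmartGrid

namespace Model

variable {N T M : ℕ} {D : Model N T M}

/-- Expected welfare of one day at the announced prices `p`, with the optimal base powers. -/
noncomputable def bestWelfare (D : Model N T M) (j : Fin M) (p : Fin T → ℝ) : ℝ :=
  ∑ t, (D.meanUtility t (p t) - D.meanCost j t (p t))

lemma bestWelfare_eq_expWelfare (j : Fin M) (p : Fin T → ℝ) :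
    D.bestWelfare j p
      = D.expWelfare j p (fun t => D.optBase j t (D.totalPlannedLoad t (p t))) := by
  simp only [bestWelfare, expWelfare, meanCost_eq]

lemma Assumptions.expWelfare_le_bestWelfare (hD : D.Assumptions) (hP : D.P.Nonempty) (j : Fin M)
    (p : Fin T → ℝ) {b : Fin T → ℝ} (hb : ∀ t, 0 ≤ b t) :
    D.expWelfare j p b ≤ D.bestWelfare j p := by
  rw [bestWelfare_eq_expWelfare]
  exact Finset.sum_le_sum fun t _ => sub_le_sub_left (hD.expCost_optBase_le hP j t _ (hb t)) _

lemma Assumptions.exists_optBase_bound (hD : D.Assumptions) (hP : D.P.Nonempty) :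
    ∃ C, ∀ j t p, |D.optBase j t (D.totalPlannedLoad t p)| ≤ C := by
  obtain ⟨R, hR0, hR⟩ := hD.exists_totalPlannedLoad_bound hP
  have h : ∀ x : Fin M × Fin T, ∃ C, ∀ L ∈ Set.Icc (-R) R, ‖D.optBase x.1 x.2 L‖ ≤ C :=
    fun x => isCompact_Icc.exists_bound_of_continuousOn (continuous_optBase x.1 x.2).continuousOn
  choose c hc using h
  obtain ⟨C, hC⟩ := (Set.finite_range c).bddAbove
  exact ⟨C, fun j t p => (hc (j, t) _ (abs_le.1 (hR t p))).trans (hC ⟨_, rfl⟩)⟩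

/-- Expected loads of the users over one day, and expected welfare with the optimal base powers,
at the announced prices `p`. -/
noncomputable def outcome (D : Model N T M) (j : Fin M) (p : Fin T → ℝ) : (Fin N → ℝ) × ℝ :=
  (fun n => ∑ t, D.plannedLoad n t (p t), D.bestWelfare j p)

/-- Outcomes of the randomized pricing rules with finite support. -/
noncomputable def attainable (D : Model N T M) (j : Fin M) : Set ((Fin N → ℝ) × ℝ) :=
  convexHull ℝ (D.outcome j '' D.P)

namespace Realization

variable {Ω : Type*} [MeasurableSpace Ω] {μ : Measure Ω}

lemma info_le_comap (S : D.Realization μ) (k : ℕ) :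
    S.info k ≤ MeasurableSpace.comap (fun ω => (S.history k ω, S.market k ω)) inferInstance := by
  set F := fun ω => (S.history k ω, S.market k ω) with hF
  have hFm : Measurable[MeasurableSpace.comap F inferInstance] F := comap_measurable F
  have hday : ∀ i < k, Measurable[MeasurableSpace.comap F inferInstance] fun ω =>
      (S.market i ω, S.rtPrice i ω, S.renewable i ω, S.noise i ω, S.seed i ω) := by
    intro i hi
    have hm : Measurable fun x : History N T M k × Fin M => x.1.1 ⟨i, by simpa using hi⟩ := by
      fun_prop
    exact hm.comp hFm
  refine sup_le (iSup₂_le fun i hi => ?_) (iSup₂_le fun i hi => ?_)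
  · rw [← measurable_iff_comap_le]
    rcases hi.eq_or_lt with rfl | hlt
    · have hm : Measurable fun x : History N T M i × Fin M => (x.2, x.1.2) := by fun_prop
      exact hm.comp hFm
    · have hm : Measurable fun x : Fin M × (Fin T → ℝ) × (Fin T → ℝ) × (Fin N → Fin T → ℝ) × ℝ =>
        (x.1, x.2.2.2.2) := by fun_prop
      exact hm.comp (hday i hlt)
  · rw [← measurable_iff_comap_le]
    have hm : Measurable fun x : Fin M × (Fin T → ℝ) × (Fin T → ℝ) × (Fin N → Fin T → ℝ) × ℝ =>
        (x.2.1, x.2.2.1, x.2.2.2.1) := by fun_prop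
    exact hm.comp (hday i hi)

/-- Doob–Dynkin factorization through history and price pair, with the finite-valued pair curried
out. -/
lemma exists_factorization {S : D.Realization μ} {k : ℕ} {g : Ω → Fin T → ℝ}
    (hg : Measurable[S.info k] g) : ∃ G : Fin M → History N T M k → Fin T → ℝ,
      (∀ j, Measurable (G j)) ∧ ∀ ω, g ω = G (S.market k ω) (S.history k ω) := by
  obtain ⟨G, hG, hgG⟩ :=
    (hg.mono (S.info_le_comap k) le_rfl).exists_eq_measurable_comp
  exact ⟨fun j h => G (h, j), fun j => hG.comp (measurable_id.prodMk measurable_const),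
    fun ω => congrFun hgG ω⟩

variable [IsProbabilityMeasure μ] {S : D.Realization μ} {k : ℕ}

lemma integrable_bestWelfare {p : Fin M → History N T M k → Fin T → ℝ} (hD : D.Assumptions)
    (hP : D.P.Nonempty) (hp : ∀ j, Measurable (p j)) (j : Fin M) :
    Integrable (fun ω => D.bestWelfare j (p j (S.history k ω))) μ := by
  obtain ⟨C, hC⟩ := hD.exists_optBase_bound hP
  simp_rw [bestWelfare_eq_expWelfare]
  refine integrable_expWelfare (b := fun j h t =>
    D.optBase j t (D.totalPlannedLoad t (p j h t))) hD hP hp (fun j => ?_)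
    (fun j h t => hC j t (p j h t)) j
  refine measurable_pi_lambda _ fun t => (continuous_optBase j t).measurable.comp ?_
  exact (hD.measurable_totalPlannedLoad hP t).comp ((measurable_pi_apply t).comp (hp j))

lemma integrable_outcome {p : Fin M → History N T M k → Fin T → ℝ} (hD : D.Assumptions)
    (hP : D.P.Nonempty) (hp : ∀ j, Measurable (p j)) (j : Fin M) :
    Integrable (fun ω => D.outcome j (p j (S.history k ω))) μ :=
  Integrable.prodMk (Integrable.of_eval fun n => integrable_finsetSum _ fun t _ =>
    integrable_planned_history hD hP hp j n t) (integrable_bestWelfare hD hP hp j)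

/-- The mean of a random point of a closed convex set lies in that set. -/
lemma integral_outcome_mem {p : Fin M → History N T M k → Fin T → ℝ} (hD : D.Assumptions)
    (hP : D.P.Nonempty) (hp : ∀ j, Measurable (p j)) (hpP : ∀ j h, p j h ∈ D.P) (j : Fin M) :
    ∫ ω, D.outcome j (p j (S.history k ω)) ∂μ ∈ closure (D.attainable j) :=
  (convex_convexHull ℝ _).closure.integral_mem isClosed_closure
    (Eventually.of_forall fun _ => subset_closure
      (subset_convexHull ℝ _ ⟨_, hpP j _, rfl⟩)) (integrable_outcome hD hP hp j)

lemma integral_outcome_eq {p : Fin M → History N T M k → Fin T → ℝ} (hD : D.Assumptions)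
    (hP : D.P.Nonempty) (hp : ∀ j, Measurable (p j)) (j : Fin M) :
    ∫ ω, D.outcome j (p j (S.history k ω)) ∂μ
      = (fun n => ∑ t, ∫ ω, D.plannedLoad n t (p j (S.history k ω) t) ∂μ,
        ∫ ω, D.bestWelfare j (p j (S.history k ω)) ∂μ) := by
  have hi : Integrable (fun ω => fun n => ∑ t, D.plannedLoad n t (p j (S.history k ω) t)) μ :=
    Integrable.of_eval fun n => integrable_finsetSum _ fun t _ =>
      integrable_planned_history hD hP hp j n t
  refine (integral_pair hi (integrable_bestWelfare hD hP hp j)).trans ?_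
  congr 1
  ext n
  rw [eval_integral fun n => hi.eval n,
    integral_finsetSum _ fun t _ => integrable_planned_history hD hP hp j n t]

/-- The expected loads of one day, together with an upper bound on the expected welfare, are
averages over the market price pairs of limits of attainable outcomes. -/
lemma Policy.exists_outcome (hD : D.Assumptions) (hP : D.P.Nonempty) (A : S.Policy) (k : ℕ)
    (hA : Integrable (A.welfare k) μ) :
    ∃ y : Fin M → (Fin N → ℝ) × ℝ, (∀ j, y j ∈ closure (D.attainable j)) ∧
      (∀ n, ∑ t, ∫ ω, A.load n k t ω ∂μ = ∑ j, D.marketProb j * (y j).1 n) ∧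
      ∫ ω, A.welfare k ω ∂μ ≤ ∑ j, D.marketProb j * (y j).2 := by
  classical
  obtain ⟨p₀, hp₀⟩ := hP
  have hP : D.P.Nonempty := ⟨p₀, hp₀⟩
  obtain ⟨G, hG, hAG⟩ := exists_factorization (A.price_adapted k)
  obtain ⟨H, hH, hAH⟩ := exists_factorization (A.base_adapted k)
  obtain ⟨R, hR0, hR⟩ := hD.exists_totalPlannedLoad_bound hP
  obtain ⟨Q, hQ0, hQ⟩ := hD.exists_effRenewable_bound hP
  -- A base power `R + Q` almost surely covers every aggregate load. Capping at this level leaves no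
  -- deficit where it acts, so it can only lower the cost, and it makes the base power bounded,
  -- hence integrable.
  set C := R + Q with hC
  have hC0 : 0 ≤ C := by positivity
  set p : Fin M → History N T M k → Fin T → ℝ := fun j h => if G j h ∈ D.P then G j h else p₀
    with hpdef
  set b : Fin M → History N T M k → Fin T → ℝ := fun j h t => min (max (H j h t) 0) C with hbdef
  have hp : ∀ j, Measurable (p j) := fun j =>
    Measurable.ite (hG j hD.compact_P.isClosed.measurableSet) (hG j) measurable_const
  have hpP : ∀ j h, p j h ∈ D.P := by
    intro j h
    simp only [hpdef]
    split_ifs with hh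
    exacts [hh, hp₀]
  have hb : ∀ j, Measurable (b j) := fun j => measurable_pi_lambda _ fun t =>
    (((measurable_pi_apply t).comp (hH j)).max measurable_const).min measurable_const
  have hb0 : ∀ j h t, 0 ≤ b j h t := fun j h t => le_min (le_max_right _ _) hC0
  have hbC : ∀ j h t, |b j h t| ≤ C := fun j h t => by
    rw [abs_of_nonneg (hb0 j h t)]
    exact min_le_right _ _
  have hprice : ∀ ω, A.price k ω = p (S.market k ω) (S.history k ω) := by
    intro ω
    have := A.price_mem k ω
    simp only [hpdef]
    rw [hAG] at this ⊢
    rw [if_pos this]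
  have hbase : ∀ ω t, b (S.market k ω) (S.history k ω) t = min (A.base k ω t) C := by
    intro ω t
    have := A.base_nonneg k ω t
    simp only [hbdef]
    rw [hAH] at this ⊢
    rw [max_eq_left this]
  refine ⟨fun j => ∫ ω, D.outcome j (p j (S.history k ω)) ∂μ,
    integral_outcome_mem hD hP hp hpP, fun n => ?_, ?_⟩
  · simp_rw [integral_outcome_eq hD hP hp, Finset.mul_sum]
    rw [Finset.sum_comm]
    refine Finset.sum_congr rfl fun t _ => ?_
    rw [← integral_load hD hP hp n t]
    simp only [Policy.load, hprice]
  · simp_rw [integral_outcome_eq hD hP hp]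
    calc ∫ ω, A.welfare k ω ∂μ
        ≤ ∫ ω, D.dayWelfare (S.market k ω) (S.rtPrice k ω) (p (S.market k ω) (S.history k ω))
            (b (S.market k ω) (S.history k ω)) (S.shock k ω) ∂μ := by
          refine integral_mono_ae hA (integrable_dayWelfare hD hP hp hb hbC) ?_
          filter_upwards [ae_all_iff.2 fun t => S.ae_shock k (hQ t),
            ae_all_iff.2 fun t => S.rtPrice_bounds k t] with ω hω hα
          refine Finset.sum_le_sum fun t _ => sub_le_sub ?_ ?_
          · simp only [Policy.load, hprice]
            rfl
          · simp only [Policy.cost, Policy.load, ← hprice, hbase]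
            have hβ := (hD.beta_bounds (S.market k ω) t).1
            refine add_le_add (mul_le_mul_of_nonneg_left (min_le_left _ _) hβ)
              (mul_le_mul_of_nonneg_left ?_ (hα t).1)
            rcases le_total (A.base k ω t) C with h | h
            · rw [min_eq_left h]
              rfl
            · rw [min_eq_right h]
              refine le_trans (max_le ?_ le_rfl) (le_max_right _ _)
              have h1 := (abs_le.1 (hR t (A.price k ω t))).2
              have h2 := (abs_le.1 (hω t)).1
              have h3 := sum_load_sub (D := D) (A.price k ω t) t C (S.shock k ω)
              have h4 : ∑ n, (D.plannedLoad n t (A.price k ω t) + (S.shock k ω).2 n t) - C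
                  - (S.shock k ω).1 t ≤ 0 := by
                rw [h3]
                linarith
              exact h4
      _ = ∑ j, D.marketProb j *
            ∫ ω, D.expWelfare j (p j (S.history k ω)) (b j (S.history k ω)) ∂μ :=
          integral_dayWelfare hD hP hp hb hbC
      _ ≤ _ := by
          refine Finset.sum_le_sum fun j _ => mul_le_mul_of_nonneg_left ?_ (hD.marketProb_nonneg j)
          exact integral_mono (integrable_expWelfare hD hP hp hb hbC j)
            (integrable_bestWelfare hD hP hp j)
            fun ω => hD.expWelfare_le_bestWelfare hP j _ (hb0 j _)

end Realization

end Model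

end SmartGrid

/-! ### From averaged outcomes to stationary rules: the upper bound. -/

namespace SmartGrid

/-- A finite convex combination, rewritten as a countable one. -/
lemma exists_countable_weights {ι X : Type*} [Fintype ι] {s : Set X} (hs : s.Nonempty) {w : ι → ℝ}
    {x : ι → X} (hw : ∀ i, 0 ≤ w i) (hw1 : ∑ i, w i = 1) (hx : ∀ i, x i ∈ s) :
    ∃ (y : ℕ → X) (a : ℕ → ℝ), (∀ m, y m ∈ s) ∧ (∀ m, 0 ≤ a m) ∧ HasSum a 1 ∧
      ∀ f : X → ℝ, HasSum (fun m => a m * f (y m)) (∑ i, w i * f (x i)) := by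
  obtain ⟨x₀, hx₀⟩ := hs
  let g : ι → ℕ := fun i => Fintype.equivFin ι i
  have hg : Function.Injective g := Fin.val_injective.comp (Fintype.equivFin ι).injective
  set y : ℕ → X := Function.extend g x fun _ => x₀
  set a : ℕ → ℝ := Function.extend g w 0
  have hy : ∀ i, y (g i) = x i := fun i => hg.extend_apply _ _ i
  have ha : ∀ i, a (g i) = w i := fun i => hg.extend_apply _ _ i
  have hy' : ∀ m ∉ Set.range g, y m = x₀ := fun m hm => Function.extend_apply' _ _ _ hm
  have ha' : ∀ m ∉ Set.range g, a m = 0 := fun m hm => Function.extend_apply' _ _ _ hm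
  have hsum : ∀ f : X → ℝ, HasSum (fun m => a m * f (y m)) (∑ i, w i * f (x i)) := by
    intro f
    rw [← hg.hasSum_iff fun m hm => by rw [ha' m hm, zero_mul]]
    convert hasSum_fintype (fun i => w i * f (x i)) using 2 with i
    simp [hy, ha]
  refine ⟨y, a, fun m => ?_, fun m => ?_, ?_, hsum⟩
  · by_cases hm : m ∈ Set.range g
    · obtain ⟨i, rfl⟩ := hm
      rw [hy]
      exact hx i
    · rw [hy' m hm]
      exact hx₀
  · by_cases hm : m ∈ Set.range g
    · obtain ⟨i, rfl⟩ := hm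
      rw [ha]
      exact hw i
    · rw [ha' m hm]
  · simpa [hw1] using hsum fun _ => 1

namespace Model

variable {N T M : ℕ} {D : Model N T M}

/-- Whole price vectors are mixed, separately for each pair, so one set of weights produces all the
loads and the welfare at once. -/
lemma exists_rule_of_mem_attainable (hP : D.P.Nonempty) {y : Fin M → (Fin N → ℝ) × ℝ}
    (hy : ∀ j, y j ∈ D.attainable j) : ∃ R : D.StationaryRule,
      (∀ n, R.loadAv n = ∑ j, D.marketProb j * (y j).1 n) ∧
      R.utilityAv - R.costAv = ∑ j, D.marketProb j * (y j).2 := by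
  have h : ∀ j, ∃ (p : ℕ → Fin T → ℝ) (a : ℕ → ℝ), (∀ m, p m ∈ D.P) ∧ (∀ m, 0 ≤ a m) ∧
      HasSum a 1 ∧ (∀ n, ∑ t, ∑' m, a m * D.plannedLoad n t (p m t) = (y j).1 n) ∧
      ∑ t, ∑' m, a m * D.meanUtility t (p m t) - ∑ t, ∑' m, a m * D.meanCost j t (p m t)
        = (y j).2 := by
    intro j
    obtain ⟨ι, _, w, z, hw, hw1, hz, hzy⟩ := mem_convexHull_iff_exists_fintype.1 (hy j)
    choose x hx hxz using hz
    obtain ⟨p, a, hp, ha, ha1, hsum⟩ := exists_countable_weights hP hw hw1 hx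
    refine ⟨p, a, hp, ha, ha1, fun n => ?_, ?_⟩
    · rw [Finset.sum_congr rfl fun t _ => (hsum fun q => D.plannedLoad n t (q t)).tsum_eq,
        Finset.sum_comm, ← hzy, Prod.fst_sum, Finset.sum_apply]
      refine Finset.sum_congr rfl fun i _ => ?_
      rw [← hxz, ← Finset.mul_sum]
      rfl
    · rw [Finset.sum_congr rfl fun t _ => (hsum fun q => D.meanUtility t (q t)).tsum_eq,
        Finset.sum_congr rfl fun t _ => (hsum fun q => D.meanCost j t (q t)).tsum_eq,
        Finset.sum_comm, Finset.sum_comm (γ := Fin T), ← hzy, Prod.snd_sum,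
        ← Finset.sum_sub_distrib]
      refine Finset.sum_congr rfl fun i _ => ?_
      rw [← hxz, ← Finset.mul_sum, ← Finset.mul_sum, ← mul_sub, ← Finset.sum_sub_distrib]
      rfl
  choose p a hp ha ha1 hload hval using h
  refine ⟨⟨p, a, hp, ha, ha1⟩, fun n => ?_, ?_⟩
  · exact Finset.sum_congr rfl fun j _ => by rw [← hload j n]
  · unfold StationaryRule.utilityAv StationaryRule.costAv
    rw [← Finset.sum_sub_distrib]
    exact Finset.sum_congr rfl fun j _ => by rw [← hval j, mul_sub]

lemma Assumptions.abs_sum_marketProb_sub_le (hD : D.Assumptions) {u v : Fin M → ℝ} {ε : ℝ}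
    (h : ∀ j, |u j - v j| ≤ ε) :
    |∑ j, D.marketProb j * u j - ∑ j, D.marketProb j * v j| ≤ ε := by
  rw [← Finset.sum_sub_distrib]
  refine (Finset.abs_sum_le_sum_abs _ _).trans ?_
  calc ∑ j, |D.marketProb j * u j - D.marketProb j * v j|
      ≤ ∑ j, D.marketProb j * ε := Finset.sum_le_sum fun j _ => by
        rw [← mul_sub, abs_mul, abs_of_nonneg (hD.marketProb_nonneg j)]
        exact mul_le_mul_of_nonneg_left (h j) (hD.marketProb_nonneg j)
    _ = ε := by rw [← Finset.sum_mul, hD.marketProb_sum, one_mul]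

/-- A welfare that is approached by limits of attainable outcomes which nearly satisfy the
quality-of-usage constraints does not exceed the static value: mixing with the price vector at which
all users plan their maximum loads restores the constraints. -/
lemma Assumptions.le_staticValue (hD : D.Assumptions) (hT : 0 < T)
    (hfull : ∃ p ∈ D.P, ∀ n t, D.plannedLoad n t (p t) = D.LdMax n) (c : ℝ)
    (h : ∀ ε > 0, ∃ y : Fin M → (Fin N → ℝ) × ℝ, (∀ j, y j ∈ closure (D.attainable j)) ∧
      (∀ n, (T : ℝ) * D.Lav n - ε ≤ ∑ j, D.marketProb j * (y j).1 n) ∧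
      c - ε ≤ ∑ j, D.marketProb j * (y j).2) :
    (c : EReal) ≤ D.staticValue := by
  obtain ⟨q, hq, hqfull⟩ := hfull
  have hP : D.P.Nonempty := ⟨q, hq⟩
  have h' : ∀ ε > 0, ∃ y : Fin M → (Fin N → ℝ) × ℝ, (∀ j, y j ∈ D.attainable j) ∧
      (∀ n, (T : ℝ) * D.Lav n - ε ≤ ∑ j, D.marketProb j * (y j).1 n) ∧
      c - ε ≤ ∑ j, D.marketProb j * (y j).2 := by
    intro ε hε
    obtain ⟨y, hy, hload, hval⟩ := h (ε / 2) (by positivity)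
    choose z hz hdist using fun j => Metric.mem_closure_iff.1 (hy j) (ε / 2) (by positivity)
    have h1 : ∀ j n, |(y j).1 n - (z j).1 n| ≤ ε / 2 := fun j n =>
      ((dist_le_pi_dist (y j).1 (z j).1 n).trans (le_max_left _ _)).trans (hdist j).le
    have h2 : ∀ j, |(y j).2 - (z j).2| ≤ ε / 2 := fun j =>
      (le_max_right (dist (y j).1 (z j).1) _).trans (hdist j).le
    refine ⟨z, hz, fun n => ?_, ?_⟩
    · have := abs_le.1 (hD.abs_sum_marketProb_sub_le fun j => h1 j n)
      linarith [hload n]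
    · have := abs_le.1 (hD.abs_sum_marketProb_sub_le h2)
      linarith
  obtain ⟨δ, hδ, hδw⟩ : ∃ δ > 0, ∀ n, δ ≤ D.wMax n := by
    rcases isEmpty_or_nonempty (Fin N) with hN | hN
    · exact ⟨1, one_pos, fun n => hN.elim n⟩
    · obtain ⟨n, hn⟩ := Finite.exists_min D.wMax
      exact ⟨D.wMax n, hD.wMax_pos hP hT n, hn⟩
  set v := ∑ j, D.marketProb j * D.bestWelfare j q
  have key : ∀ θ ∈ Set.Ioo (0 : ℝ) 1,
      (((1 - θ) * (c - θ * δ) + θ * v : ℝ) : EReal) ≤ D.staticValue := by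
    intro θ hθ
    -- The tolerance matches the gain: weight `θ` on the full-load price adds at least `θ * δ` over
    -- the requirement, the other part loses at most `(1 - θ) * θ * δ`, and `θ * θ * δ` is left
    -- over.
    obtain ⟨y, hy, hload, hval⟩ := h' (θ * δ) (mul_pos hθ.1 hδ)
    have hmix : ∀ j, (1 - θ) • y j + θ • D.outcome j q ∈ D.attainable j := fun j =>
      (convex_convexHull ℝ _) (hy j) (subset_convexHull ℝ _ ⟨q, hq, rfl⟩)
        (by linarith [hθ.2]) hθ.1.le (by ring)
    obtain ⟨R, hRload, hRval⟩ := exists_rule_of_mem_attainable hP hmix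
    have hfeas : R.Feasible := by
      intro n
      rw [hRload n]
      have h1 : ∑ j, D.marketProb j * ((1 - θ) • y j + θ • D.outcome j q).1 n
          = (1 - θ) * ∑ j, D.marketProb j * (y j).1 n + θ * (T * D.LdMax n) := by
        have h2 : ∀ j, D.marketProb j * ((1 - θ) • y j + θ • D.outcome j q).1 n
            = (1 - θ) * (D.marketProb j * (y j).1 n)
              + θ * (T * D.LdMax n) * D.marketProb j := by
          intro j
          simp [outcome, hqfull]
          ring
        rw [Finset.sum_congr rfl fun j _ => h2 j, Finset.sum_add_distrib, ← Finset.mul_sum,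
          ← Finset.mul_sum, hD.marketProb_sum, mul_one]
      rw [h1]
      have hT1 : (1 : ℝ) ≤ T := by exact_mod_cast hT
      have h3 : (T : ℝ) * D.Lav n + δ ≤ T * D.LdMax n := by
        have := hD.Lav_le n
        have := hδw n
        nlinarith
      have h4 := mul_le_mul_of_nonneg_left (hload n) (by linarith [hθ.2] : (0 : ℝ) ≤ 1 - θ)
      have h5 := mul_le_mul_of_nonneg_left h3 hθ.1.le
      have h6 : 0 ≤ θ * θ * δ := by have := hθ.1; positivity
      nlinarith
    refine le_trans ?_ (le_sSup ⟨R, hfeas, rfl⟩)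
    rw [EReal.coe_le_coe_iff, hRval]
    have h1 : ∑ j, D.marketProb j * ((1 - θ) • y j + θ • D.outcome j q).2
        = (1 - θ) * ∑ j, D.marketProb j * (y j).2 + θ * v := by
      rw [Finset.mul_sum, Finset.mul_sum, ← Finset.sum_add_distrib]
      refine Finset.sum_congr rfl fun j _ => ?_
      simp [outcome]
      ring
    rw [h1]
    have := mul_le_mul_of_nonneg_left hval (by linarith [hθ.2] : (0 : ℝ) ≤ 1 - θ)
    linarith
  have hlim : Tendsto (fun θ : ℝ => (((1 - θ) * (c - θ * δ) + θ * v : ℝ) : EReal))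
      (nhdsWithin 0 (Set.Ioi 0)) (nhds (c : EReal)) := by
    have hc : Continuous fun θ : ℝ => (((1 - θ) * (c - θ * δ) + θ * v : ℝ) : EReal) :=
      continuous_coe_real_ereal.comp (by fun_prop)
    have := (hc.tendsto 0).mono_left (nhdsWithin_le_nhds (s := Set.Ioi 0))
    simpa using this
  refine le_of_tendsto hlim ?_
  filter_upwards [Ioo_mem_nhdsGT (zero_lt_one : (0 : ℝ) < 1)] with θ hθ
  exact key θ hθ

namespace Realization

variable {Ω : Type*} [MeasurableSpace Ω] {μ : Measure Ω} [IsProbabilityMeasure μ]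
  {S : D.Realization μ}

lemma Policy.welfareAv_le_staticValue (hD : D.Assumptions) (hT : 0 < T)
    (hfull : ∃ p ∈ D.P, ∀ n t, D.plannedLoad n t (p t) = D.LdMax n) (A : S.Policy)
    (hA : A.Feasible) : A.welfareAv ≤ D.staticValue := by
  have hP : D.P.Nonempty := let ⟨q, hq, _⟩ := hfull; ⟨q, hq⟩
  have hT0 : (0 : ℝ) < T := by exact_mod_cast hT
  refine le_of_forall_lt_imp_le_of_dense fun r hr => ?_
  -- A real `c` strictly below the average welfare avoids a separate treatment of infinite values.
  obtain ⟨c, hrc, hc⟩ := EReal.lt_iff_exists_real_btwn.1 hr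
  refine hrc.le.trans (hD.le_staticValue hT hfull c fun ε hε => ?_)
  choose y hy hload hval using fun k => A.exists_outcome hD hP k (hA.1 k)
  have h1 := eventually_lt_of_lt_liminf hc
  -- The constraint is per slot; multiplication by `T` turns the tolerance `ε / T` into the daily
  -- one `ε`. As there are finitely many users, one `K` serves them all together with the welfare.
  have h2 : ∀ n, ∀ᶠ K : ℕ in atTop, ((D.Lav n - ε / T : ℝ) : EReal)
      < ((1 / ((K : ℝ) * (T : ℝ)) * ∑ k ∈ Finset.range K, ∑ t, ∫ ω, A.load n k t ω ∂μ : ℝ)) :=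
    fun n => eventually_lt_of_lt_liminf
      (lt_of_lt_of_le (EReal.coe_lt_coe_iff.2 (by have := div_pos hε hT0; linarith)) (hA.2 n))
  obtain ⟨K, hK1, hK2, hK⟩ := (h1.and ((eventually_all.2 h2).and (eventually_ge_atTop 1))).exists
  have hK0 : (0 : ℝ) < K := by exact_mod_cast hK
  rw [EReal.coe_lt_coe_iff] at hK1
  refine ⟨fun j => ∑ k ∈ Finset.range K, (1 / (K : ℝ)) • y k j, fun j => ?_, fun n => ?_, ?_⟩
  · refine (convex_convexHull ℝ _).closure.sum_mem (fun k _ => by positivity) ?_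
      fun k _ => hy k j
    simp [hK0.ne']
  · have hn := hK2 n
    rw [EReal.coe_lt_coe_iff] at hn
    have heq : ∑ j, D.marketProb j * (∑ k ∈ Finset.range K, (1 / (K : ℝ)) • y k j).1 n
        = T * (1 / ((K : ℝ) * T) * ∑ k ∈ Finset.range K, ∑ t, ∫ ω, A.load n k t ω ∂μ) := by
      simp_rw [hload, Prod.fst_sum, Finset.sum_apply, Finset.mul_sum]
      rw [Finset.sum_comm]
      refine Finset.sum_congr rfl fun k _ => Finset.sum_congr rfl fun j _ => ?_
      simp only [Prod.smul_fst, Pi.smul_apply, smul_eq_mul]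
      field_simp
    rw [heq]
    have := mul_lt_mul_of_pos_left hn hT0
    rw [mul_sub, mul_div_cancel₀ _ hT0.ne'] at this
    exact this.le
  · have heq : ∑ j, D.marketProb j * (∑ k ∈ Finset.range K, (1 / (K : ℝ)) • y k j).2
        = 1 / (K : ℝ) * ∑ k ∈ Finset.range K, ∑ j, D.marketProb j * (y k j).2 := by
      simp_rw [Prod.snd_sum, Finset.mul_sum]
      rw [Finset.sum_comm]
      refine Finset.sum_congr rfl fun k _ => Finset.sum_congr rfl fun j _ => ?_
      simp only [Prod.smul_snd, smul_eq_mul]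
      ring
    rw [heq]
    have := mul_le_mul_of_nonneg_left (Finset.sum_le_sum fun k (_ : k ∈ Finset.range K) => hval k)
      (by positivity : 0 ≤ 1 / (K : ℝ))
    linarith

end Realization

end Model

end SmartGrid

/-! ### Implementing a stationary rule by a policy: the lower bound. -/

namespace SmartGrid

/-- A random variable on the unit interval with prescribed distribution on `ℕ`. -/
lemma exists_index_of_hasSum {a : ℕ → ℝ} (ha : ∀ m, 0 ≤ a m) (ha1 : HasSum a 1) :
    ∃ f : ℝ → ℕ, Measurable f ∧ ∀ F : ℕ → ℝ, (∃ K, ∀ m, |F m| ≤ K) →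
      ∫ x in Set.Icc (0 : ℝ) 1, F (f x) = ∑' m, a m * F m := by
  let q : PMF ℕ := ⟨fun m => ENNReal.ofReal (a m), by
    rw [ENNReal.summable.hasSum_iff, ← ENNReal.ofReal_tsum_of_nonneg ha ha1.summable, ha1.tsum_eq,
      ENNReal.ofReal_one]⟩
  -- The law on `ℕ` is realized as an image of the uniform law on the unit interval; `projIcc` then
  -- extends the map to the line, where values off the interval do not matter.
  obtain ⟨f, hf, hfq⟩ := Measure.exists_measurable_map_eq q.toMeasure
  have hproj : Measurable (Set.projIcc (0 : ℝ) 1 zero_le_one) := continuous_projIcc.measurable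
  refine ⟨fun x => f (Set.projIcc 0 1 zero_le_one x), hf.comp hproj, fun F hF => ?_⟩
  obtain ⟨K, hK⟩ := hF
  have hFm : Measurable F := measurable_of_countable F
  have hFi : Integrable F q.toMeasure :=
    Integrable.of_bound hFm.aestronglyMeasurable K (Eventually.of_forall hK)
  calc ∫ x in Set.Icc (0 : ℝ) 1, F (f (Set.projIcc 0 1 zero_le_one x))
      = ∫ x : unitInterval, F (f (Set.projIcc 0 1 zero_le_one (x : ℝ))) :=
        (integral_subtype_comap (μ := volume) measurableSet_Icc
          fun x : ℝ => F (f (Set.projIcc 0 1 zero_le_one x))).symm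
    _ = ∫ x : unitInterval, F (f x) := by simp_rw [Set.projIcc_val]
    _ = ∫ m, F m ∂q.toMeasure := by
        rw [← hfq, integral_map hf.aemeasurable hFm.aestronglyMeasurable]
    _ = ∑' m, a m * F m := by
        rw [PMF.integral_eq_tsum q F hFi]
        refine tsum_congr fun m => ?_
        rw [smul_eq_mul]
        congr 1
        exact ENNReal.toReal_ofReal (ha m)

namespace Model

variable {N T M : ℕ} {D : Model N T M}

lemma Assumptions.exists_meanUtility_bound (hD : D.Assumptions) (hP : D.P.Nonempty) (t : Fin T) :
    ∃ K, ∀ p, |D.meanUtility t p| ≤ K := by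
  obtain ⟨R, -, hR⟩ := hD.exists_plannedLoad_bound hP
  choose K hK using fun n => (isCompact_Icc (a := -R) (b := R)).exists_bound_of_continuousOn
    (hD.continuous_expUtility hP n t).continuousOn
  exact ⟨∑ n, K n, fun p => (Finset.abs_sum_le_sum_abs _ _).trans
    (Finset.sum_le_sum fun n _ => hK n _ (abs_le.1 (hR n t p)))⟩

lemma Assumptions.exists_meanCost_bound (hD : D.Assumptions) (hP : D.P.Nonempty) (j : Fin M)
    (t : Fin T) : ∃ K, ∀ p, |D.meanCost j t p| ≤ K := by
  obtain ⟨R, -, hR⟩ := hD.exists_totalPlannedLoad_bound hP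
  have hcont : Continuous fun L => D.expCost j t L (D.optBase j t L) := by
    have h1 := hD.continuous_expDeficit hP t
    have h2 := continuous_optBase (D := D) j t
    unfold expCost
    fun_prop
  obtain ⟨K, hK⟩ := (isCompact_Icc (a := -R) (b := R)).exists_bound_of_continuousOn
    hcont.continuousOn
  refine ⟨K, fun p => ?_⟩
  rw [meanCost_eq]
  exact hK _ (abs_le.1 (hR t p))

lemma summable_mul_of_bounded {a F : ℕ → ℝ} (ha : ∀ m, 0 ≤ a m) (hs : Summable a)
    (hF : ∃ K, ∀ m, |F m| ≤ K) : Summable fun m => a m * F m := by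
  obtain ⟨K, hK⟩ := hF
  refine Summable.of_norm_bounded (hs.mul_right K) fun m => ?_
  rw [Real.norm_eq_abs, abs_mul, abs_of_nonneg (ha m)]
  exact mul_le_mul_of_nonneg_left (hK m) (ha m)

namespace StationaryRule

/-- Utility and cost are bounded over all prices, so every series converges and may be exchanged
with the sum over slots; a divergent `tsum` would default to `0`. -/
lemma tsum_bestWelfare (hD : D.Assumptions) (hP : D.P.Nonempty) (R : D.StationaryRule)
    (j : Fin M) : ∑' m, R.weight j m * D.bestWelfare j (R.price j m)
      = ∑ t, ∑' m, R.weight j m * D.meanUtility t (R.price j m t)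
        - ∑ t, ∑' m, R.weight j m * D.meanCost j t (R.price j m t) := by
  have hu : ∀ t, Summable fun m => R.weight j m * D.meanUtility t (R.price j m t) := fun t =>
    summable_mul_of_bounded (R.weight_nonneg j) (R.weight_sum j).summable
      (let ⟨K, hK⟩ := hD.exists_meanUtility_bound hP t; ⟨K, fun _ => hK _⟩)
  have hc : ∀ t, Summable fun m => R.weight j m * D.meanCost j t (R.price j m t) := fun t =>
    summable_mul_of_bounded (R.weight_nonneg j) (R.weight_sum j).summable
      (let ⟨K, hK⟩ := hD.exists_meanCost_bound hP j t; ⟨K, fun _ => hK _⟩)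
  simp_rw [bestWelfare, Finset.mul_sum, mul_sub]
  rw [Summable.tsum_finsetSum fun t _ => (hu t).sub (hc t), ← Finset.sum_sub_distrib]
  exact Finset.sum_congr rfl fun t _ => (hu t).tsum_sub (hc t)

end StationaryRule

lemma Assumptions.exists_bestWelfare_bound (hD : D.Assumptions) (hP : D.P.Nonempty) (j : Fin M) :
    ∃ K, ∀ p, |D.bestWelfare j p| ≤ K := by
  choose U hU using hD.exists_meanUtility_bound hP
  choose C hC using hD.exists_meanCost_bound hP j
  exact ⟨∑ t, (U t + C t), fun p => (Finset.abs_sum_le_sum_abs _ _).trans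
    (Finset.sum_le_sum fun t _ => (abs_sub _ _).trans (add_le_add (hU t _) (hC t _)))⟩

namespace Realization

variable {Ω : Type*} [MeasurableSpace Ω] {μ : Measure Ω} [IsProbabilityMeasure μ]

omit [IsProbabilityMeasure μ] in
lemma measurable_market_seed (S : D.Realization μ) (k : ℕ) :
    Measurable[S.info k] fun ω => (S.market k ω, S.seed k ω) := by
  rw [measurable_iff_comap_le]
  exact le_sup_of_le_left (le_iSup₂_of_le k le_rfl le_rfl)

/-- Every stationary randomized pricing rule that satisfies the quality-of-usage constraints is
implemented by a feasible policy. -/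
lemma exists_policy_of_rule (hD : D.Assumptions) (hP : D.P.Nonempty) (hT : 0 < T)
    (S : D.Realization μ) (R : D.StationaryRule) (hR : R.Feasible) :
    ∃ A : S.Policy, A.Feasible ∧ ((R.utilityAv - R.costAv : ℝ) : EReal) = A.welfareAv := by
  have hT0 : (0 : ℝ) < T := by exact_mod_cast hT
  choose f hf hfF using fun j => exists_index_of_hasSum (R.weight_nonneg j) (R.weight_sum j)
  have hseed : ∀ k j (F : ℕ → ℝ), (∃ K, ∀ m, |F m| ≤ K) →
      ∫ ω, F (f j (S.seed k ω)) ∂μ = ∑' m, R.weight j m * F m := by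
    intro k j F hF
    have hm : Measurable fun x => F (f j x) := (measurable_of_countable F).comp (hf j)
    rw [← hfF j F hF, ← S.seed_law k, integral_map (S.measurable_seed k).aemeasurable
      hm.aestronglyMeasurable]
  let price : Fin M × ℝ → Fin T → ℝ := fun x => R.price x.1 (f x.1 x.2)
  let base : Fin M × ℝ → Fin T → ℝ := fun x t => D.optBase x.1 t (D.totalPlannedLoad t (price x t))
  -- Prices factor through the countable index `m` for each of the finitely many pairs, so
  -- measurability of `f j` suffices.
  have hprice : Measurable price := measurable_from_prod_countable_right fun j =>
    (measurable_of_countable (R.price j)).comp (hf j)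
  have hbase : Measurable base := measurable_from_prod_countable_right fun j =>
    measurable_pi_lambda _ fun t => (continuous_optBase j t).measurable.comp
      ((hD.measurable_totalPlannedLoad hP t).comp ((measurable_pi_apply t).comp
        ((measurable_of_countable (R.price j)).comp (hf j))))
  let A : S.Policy :=
    { price := fun k ω => price (S.market k ω, S.seed k ω)
      base := fun k ω => base (S.market k ω, S.seed k ω)
      price_adapted := fun k => hprice.comp (S.measurable_market_seed k)
      base_adapted := fun k => hbase.comp (S.measurable_market_seed k)
      price_mem := fun k ω => R.price_mem _ _
      base_nonneg := fun k ω t => optBase_nonneg _ _ _ }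
  obtain ⟨C, hC⟩ := hD.exists_optBase_bound hP
  have hp : ∀ k j, Measurable fun h : History N T M k => price (j, h.2) := fun k j =>
    hprice.comp (measurable_const.prodMk measurable_snd)
  have hb : ∀ k j, Measurable fun h : History N T M k => base (j, h.2) := fun k j =>
    hbase.comp (measurable_const.prodMk measurable_snd)
  have hint : ∀ k, Integrable (A.welfare k) μ := fun k =>
    integrable_dayWelfare (S := S) (p := fun j h => price (j, h.2))
      (b := fun j h => base (j, h.2)) hD hP (hp k) (hb k) (C := C) (fun j h t => hC j t _)
  have hwel : ∀ k, ∫ ω, A.welfare k ω ∂μ = R.utilityAv - R.costAv := by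
    intro k
    refine (integral_dayWelfare (S := S) (p := fun j h => price (j, h.2))
      (b := fun j h => base (j, h.2)) hD hP (hp k) (hb k) (C := C)
      (fun j h t => hC j t _)).trans ?_
    unfold StationaryRule.utilityAv StationaryRule.costAv
    rw [← Finset.sum_sub_distrib]
    refine Finset.sum_congr rfl fun j _ => ?_
    rw [← mul_sub, ← R.tsum_bestWelfare hD hP j]
    congr 1
    -- For fixed `j` the price depends on the history only through the seed of day `k`.
    rw [← hseed k j _ (let ⟨K, hK⟩ := hD.exists_bestWelfare_bound hP j; ⟨K, fun _ => hK _⟩)]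
    refine integral_congr_ae (Eventually.of_forall fun ω => ?_)
    exact (bestWelfare_eq_expWelfare j _).symm
  have hload : ∀ k n, ∑ t, ∫ ω, A.load n k t ω ∂μ = R.loadAv n := by
    intro k n
    obtain ⟨B, -, hB⟩ := hD.exists_plannedLoad_bound hP
    have h1 : ∀ t, ∫ ω, A.load n k t ω ∂μ = ∑ j, D.marketProb j *
        ∑' m, R.weight j m * D.plannedLoad n t (R.price j m t) := by
      intro t
      refine (integral_load (S := S) (p := fun j h => price (j, h.2)) hD hP (hp k) n t).trans ?_
      refine Finset.sum_congr rfl fun j _ => ?_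
      rw [← hseed k j (fun m => D.plannedLoad n t (R.price j m t)) ⟨B, fun _ => hB _ _ _⟩]
      rfl
    simp_rw [h1, StationaryRule.loadAv, Finset.mul_sum]
    exact Finset.sum_comm
  refine ⟨A, ⟨hint, fun n => ?_⟩, ?_⟩
  · refine le_liminf_of_le (by isBoundedDefault) ?_
    -- All days have the same expected load, so the average is constant except at `K = 0`, where
    -- division by zero makes it `0`.
    filter_upwards [eventually_ge_atTop 1] with K hK
    have hK0 : (0 : ℝ) < K := by exact_mod_cast hK
    simp_rw [hload]
    rw [EReal.coe_le_coe_iff, Finset.sum_const, Finset.card_range, nsmul_eq_mul,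
      one_div_mul_eq_div, le_div_iff₀ (by positivity)]
    have := mul_le_mul_of_nonneg_left (hR n) hK0.le
    linarith
  · unfold Policy.welfareAv
    refine (Tendsto.liminf_eq ?_).symm
    refine tendsto_const_nhds.congr' ?_
    filter_upwards [eventually_ge_atTop 1] with K hK
    have hK0 : (0 : ℝ) < K := by exact_mod_cast hK
    simp_rw [hwel]
    rw [Finset.sum_const, Finset.card_range, nsmul_eq_mul, one_div,
      inv_mul_cancel_left₀ hK0.ne']

end Realization

end Model

end SmartGrid

theorem theorem1 {N T M : ℕ} (hT : 0 < T) (D : SmartGrid.Model N T M) (hD : D.Assumptions)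
    (hfull : ∃ p ∈ D.P, ∀ n t, D.plannedLoad n t (p t) = D.LdMax n)
    {Ω : Type*} [MeasurableSpace Ω] (μ : MeasureTheory.Measure Ω)
    [MeasureTheory.IsProbabilityMeasure μ] (S : D.Realization μ) :
    S.optimalWelfare = D.staticValue := by
  have hP : D.P.Nonempty := let ⟨q, hq, _⟩ := hfull; ⟨q, hq⟩
  refine le_antisymm (sSup_le ?_) (sSup_le ?_)
  · rintro _ ⟨A, hA, rfl⟩
    exact A.welfareAv_le_staticValue hD hT hfull hA
  · rintro _ ⟨R, hR, rfl⟩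
    obtain ⟨A, hA, hval⟩ := SmartGrid.Model.Realization.exists_policy_of_rule hD hP hT S R hR
    exact hval.le.trans (le_sSup ⟨A, hA, rfl⟩)
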